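/- Let $(M,\tau)$ be a von Neumann algebra with a normal faithful trace state, let $M_h=\{a\in M: a=a^*\}$ and let $\mathbb C_{\langle n\rangle}=\mathbb C\langle X_1,\dots,X_n\rangle$ be the algebra of noncommutative polynomials. For $1\le j\le n$ let $\delta_j:\mathbb C_{\langle n\rangle}\to\mathbb C_{\langle n\rangle}$ be the partial cyclic derivative, the linear map with $$\delta_j X_{i_1}\cdots X_{i_p}=\sum_{1\le k\le p,\ i_k=j}X_{i_{k+1}}\cdots X_{i_p}X_{i_1}\cdots X_{i_{k-1}},$$ and for $T=(T_1,\dots,T_n)\in M^n$ write $\delta_jP(T)$ for the value of $\delta_jP$ at $X_i=T_i$ and $\delta P(T)=(\delta_jP(T))_{1\le j\le n}$. Let $Y_j,Z_j\in M_h$ $(1\le j\le n)$ be such that $\{Y_1,\dots,Y_n\}$ and $\{Z_1,\dots,Z_n\}$ are independent or freely independent in $(M,\tau)$; here independent means that the unital algebras $A=\mathbb C\langle Y_1,\dots,Y_n\rangle$ and $B=\mathbb C\langle Z_1,\dots,Z_n\rangle$ generated by the two sets commute and $\tau(ab)=\tau(a)\tau(b)$ for $a\in A$, $b\in B$. Let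 $W_{Y+Z}$ and $W_Z$ be the von Neumann subalgebras of $M$ generated by $\{I,Y_1+Z_1,\dots,Y_n+Z_n\}$ and by $\{I,Z_1,\dots,Z_n\}$ respectively, and let $E$ be the $\tau$-preserving conditional expectation of $M$ onto $W_{Y+Z}$. Let $\xi=(\xi_1,\dots,\xi_n)$ be an $n$-tuple of self-adjoint elements of $W_Z$ such that $$\tau\Big(\sum_{1\le j\le n}\xi_j\,\delta_jP(Z)\Big)=0\quad\text{for all }P\in\mathbb C_{\langle n\rangle}.$$ Then $$\tau\Big(\sum_{1\le j\le n}\xi_j\,\delta_jP(Y+Z)\Big)=0\quad\text{for all }P\in\mathbb C_{\langle n\rangle}.$$ In particular $(E\xi_j)_{1\le j\le n}$ is in the orthogonal of $\delta\mathbb C_{\langle n\rangle}(Y+Z)$ in $(W_{Y+Z,h})^n$: every $E\xi_j$ is a self-adjoint element of $W_{Y+Z}$, and $\sum_{1\le j\le n}\tau\big((E\xi_j)\,(\delta_jP(Y+Z))^*\big)=0$ for all $P\in\mathbb C_{\langle n\rangle}$. -/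

import Mathlib

namespace CyclicGrad

section Polynomials

/-- The value of the noncommutative monomial `X_{i₁} ⋯ X_{iₚ}` attached to a word `[i₁, …, iₚ]`. -/
noncomputable def monomial {n : ℕ} (w : List (Fin n)) : FreeAlgebra ℂ (Fin n) :=
  (w.map (FreeAlgebra.ι ℂ)).prod

/-- The partial cyclic derivative `δ_j` of the monomial `X_{i₁} ⋯ X_{iₚ}`, that is
`∑_{k : i_k = j} X_{i_{k+1}} ⋯ X_{iₚ} X_{i₁} ⋯ X_{i_{k-1}}` (positions are counted from `0`). -/
noncomputable def cyclicDerivMonomial {n : ℕ} (j : Fin n) (w : List (Fin n)) :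
    FreeAlgebra ℂ (Fin n) :=
  ∑ k : Fin w.length, if w.get k = j then monomial (w.drop (k + 1) ++ w.take k) else 0

/-- The partial cyclic derivative `δ_j : ℂ⟨X₁, …, Xₙ⟩ → ℂ⟨X₁, …, Xₙ⟩`: the linear extension
of `cyclicDerivMonomial` from the basis of monomials. -/
noncomputable def cyclicDeriv {n : ℕ} (j : Fin n) :
    FreeAlgebra ℂ (Fin n) →ₗ[ℂ] FreeAlgebra ℂ (Fin n) :=
  (FreeAlgebra.basisFreeMonoid ℂ (Fin n)).constr ℂ
    fun w => cyclicDerivMonomial j (FreeMonoid.toList w)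

end Polynomials

section Independence

variable {A : Type*} [Ring A] [Algebra ℂ A]

/-- Subalgebras `B₁, B₂` of a noncommutative probability space `(A, τ)` are (tensor, i.e.
classically) independent if they commute and `τ (b₁ b₂) = τ b₁ τ b₂`. -/
def Independent (τ : A →ₗ[ℂ] ℂ) (B₁ B₂ : Subalgebra ℂ A) : Prop :=
  ∀ b₁ ∈ B₁, ∀ b₂ ∈ B₂, Commute b₁ b₂ ∧ τ (b₁ * b₂) = τ b₁ * τ b₂

/-- Unital subalgebras `B i` of a noncommutative probability space `(A, τ)` are freely
independent if `τ (a₀ a₁ ⋯ aₘ) = 0` whenever each `a_k` is a centered element of some `B (i k)`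
and neighbouring indices `i k`, `i (k + 1)` are different. -/
def FreelyIndependent {ι : Type*} (τ : A →ₗ[ℂ] ℂ) (B : ι → Subalgebra ℂ A) : Prop :=
  ∀ (m : ℕ) (i : Fin (m + 1) → ι) (a : Fin (m + 1) → A),
    (∀ k : Fin m, i k.castSucc ≠ i k.succ) → (∀ k, a k ∈ B (i k)) → (∀ k, τ (a k) = 0) →
      τ (List.ofFn a).prod = 0

end Independence

section VonNeumann

variable {H : Type*} [NormedAddCommGroup H] [InnerProductSpace ℂ H] [CompleteSpace H]

/-- The von Neumann algebra generated by a set `S` of bounded operators: the bicommutant of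
`S ∪ S*` (`StarSubalgebra.centralizer ℂ S` is the commutant of `S ∪ S*`). It contains `1`. -/
noncomputable def vonNeumannGenerated (S : Set (H →L[ℂ] H)) : VonNeumannAlgebra H where
  toStarSubalgebra :=
    StarSubalgebra.centralizer ℂ (StarSubalgebra.centralizer ℂ S : Set (H →L[ℂ] H))
  centralizer_centralizer' := by
    have h : ((StarSubalgebra.centralizer ℂ
        (StarSubalgebra.centralizer ℂ S : Set (H →L[ℂ] H)) : StarSubalgebra ℂ (H →L[ℂ] H)) :
        Set (H →L[ℂ] H)) =
        Set.centralizer (StarSubalgebra.centralizer ℂ S : Set (H →L[ℂ] H)) := by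
      rw [StarSubalgebra.coe_centralizer]
      congr 1
      rw [Set.union_eq_left]
      intro x hx
      have hx' : star x ∈ StarSubalgebra.centralizer ℂ S := hx
      have h2 : star (star x) ∈ StarSubalgebra.centralizer ℂ S := star_mem hx'
      rwa [star_star] at h2
    change Set.centralizer (Set.centralizer ((StarSubalgebra.centralizer ℂ
        (StarSubalgebra.centralizer ℂ S : Set (H →L[ℂ] H)) : StarSubalgebra ℂ (H →L[ℂ] H)) :
        Set (H →L[ℂ] H))) = ((StarSubalgebra.centralizer ℂ
        (StarSubalgebra.centralizer ℂ S : Set (H →L[ℂ] H)) : StarSubalgebra ℂ (H →L[ℂ] H)) :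
        Set (H →L[ℂ] H))
    rw [h, Set.centralizer_centralizer_centralizer]

theorem subset_vonNeumannGenerated (S : Set (H →L[ℂ] H)) :
    S ⊆ (vonNeumannGenerated S : Set (H →L[ℂ] H)) := by
  intro x hx
  change x ∈ StarSubalgebra.centralizer ℂ (StarSubalgebra.centralizer ℂ S : Set (H →L[ℂ] H))
  rw [StarSubalgebra.mem_centralizer_iff]
  intro g hg
  rw [SetLike.mem_coe, StarSubalgebra.mem_centralizer_iff] at hg
  obtain ⟨h1, h2⟩ := hg x hx
  refine ⟨h1.symm, ?_⟩
  have := congrArg star h2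
  simpa using this

/-- `vonNeumannGenerated S` is the least von Neumann algebra that contains `S`. -/
theorem vonNeumannGenerated_le {S : Set (H →L[ℂ] H)} {N : VonNeumannAlgebra H}
    (h : S ⊆ (N : Set (H →L[ℂ] H))) : vonNeumannGenerated S ≤ N := by
  intro x hx
  change x ∈ StarSubalgebra.centralizer ℂ (StarSubalgebra.centralizer ℂ S : Set (H →L[ℂ] H)) at hx
  rw [StarSubalgebra.mem_centralizer_iff] at hx
  rw [← N.commutant_commutant, VonNeumannAlgebra.mem_commutant_iff]
  intro g hg
  rw [VonNeumannAlgebra.mem_commutant_iff] at hg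
  refine (hx g ?_).1
  rw [SetLike.mem_coe, StarSubalgebra.mem_centralizer_iff]
  exact fun s hs => ⟨hg s (h hs), hg (star s) (star_mem (h hs))⟩

/-- The ultraweak topology on a von Neumann algebra: the topology generated by the functionals
`x ↦ ∑ i, ⟪u i, x (v i)⟫` with `u, v ∈ ℓ²(ℕ, H)`. -/
noncomputable abbrev ultraweakTopology (M : VonNeumannAlgebra H) : TopologicalSpace M.toStarSubalgebra :=
  TopologicalSpace.induced
    (fun (x : M.toStarSubalgebra) (p : lp (fun _ : ℕ => H) 2 × lp (fun _ : ℕ => H) 2) =>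
      ∑' i, inner ℂ (p.1 i) ((x : H →L[ℂ] H) (p.2 i)))
    inferInstance

/-- `τ` is a normal (ultraweakly continuous) faithful trace state on `M`. -/
structure IsTraceState (M : VonNeumannAlgebra H) (τ : M.toStarSubalgebra →ₗ[ℂ] ℂ) : Prop where
  map_one : τ 1 = 1
  nonneg_re : ∀ x, 0 ≤ (τ (star x * x)).re
  im_eq_zero : ∀ x, (τ (star x * x)).im = 0
  map_mul_comm : ∀ x y, τ (x * y) = τ (y * x)
  faithful : ∀ x, τ (star x * x) = 0 → x = 0
  normal : @Continuous _ _ (ultraweakTopology M) _ τ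

/-- `E` is the `τ`-preserving conditional expectation of `M` onto its von Neumann subalgebra `N`:
a positive linear `N`-bimodule projection of `M` onto `N` with `τ ∘ E = τ`. -/
structure IsCondExp (M : VonNeumannAlgebra H) (τ : M.toStarSubalgebra →ₗ[ℂ] ℂ)
    (N : VonNeumannAlgebra H) (E : M.toStarSubalgebra →ₗ[ℂ] M.toStarSubalgebra) : Prop where
  mem : ∀ x, (E x : H →L[ℂ] H) ∈ N
  apply_of_mem : ∀ x : M.toStarSubalgebra, (x : H →L[ℂ] H) ∈ N → E x = x
  bimodule : ∀ a x b : M.toStarSubalgebra, (a : H →L[ℂ] H) ∈ N → (b : H →L[ℂ] H) ∈ N →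
    E (a * x * b) = a * E x * b
  nonneg : ∀ x : M.toStarSubalgebra, 0 ≤ (x : H →L[ℂ] H) → 0 ≤ (E x : H →L[ℂ] H)
  trace_apply : ∀ x, τ (E x) = τ x


section Existence

open Filter Topology

theorem mem_of_forall_commute {N : VonNeumannAlgebra H} {a : H →L[ℂ] H}
    (h : ∀ y ∈ N.commutant, Commute a y) : a ∈ N := by
  rw [← N.commutant_commutant, VonNeumannAlgebra.mem_commutant_iff]
  exact fun g hg => (h g hg).eq.symm

theorem commute_of_mem {N : VonNeumannAlgebra H} {a y : H →L[ℂ] H} (ha : a ∈ N)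
    (hy : y ∈ N.commutant) : Commute a y :=
  VonNeumannAlgebra.mem_commutant_iff.1 hy a ha

theorem cfc_mem {N : VonNeumannAlgebra H} {a : H →L[ℂ] H} (ha : a ∈ N) (f : ℝ → ℝ) :
    cfc f a ∈ N :=
  mem_of_forall_commute fun _ hy => (commute_of_mem ha hy).cfc_real f

theorem exists_sqrt_mem {M : VonNeumannAlgebra H} (x : M.toStarSubalgebra)
    (hx : 0 ≤ (x : H →L[ℂ] H)) : ∃ s : M.toStarSubalgebra, star s = s ∧ s * s = x := by
  have hsa : IsSelfAdjoint (x : H →L[ℂ] H) := .of_nonneg hx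
  refine ⟨⟨cfc Real.sqrt (x : H →L[ℂ] H), cfc_mem x.2 _⟩, ?_, ?_⟩
  · ext1
    exact cfc_predicate Real.sqrt (x : H →L[ℂ] H)
  · ext1
    change cfc Real.sqrt (x : H →L[ℂ] H) * cfc Real.sqrt (x : H →L[ℂ] H) = x
    rw [← cfc_mul Real.sqrt Real.sqrt (x : H →L[ℂ] H)]
    conv_rhs => rw [← cfc_id ℝ (x : H →L[ℂ] H)]
    refine cfc_congr fun t ht => ?_
    exact Real.mul_self_sqrt (spectrum_nonneg_of_nonneg hx ht)

theorem nonneg_star_mul {M : VonNeumannAlgebra H} (x : M.toStarSubalgebra) :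
    0 ≤ ((star x * x : M.toStarSubalgebra) : H →L[ℂ] H) :=
  star_mul_self_nonneg (x : H →L[ℂ] H)

namespace IsTraceState

variable {M N : VonNeumannAlgebra H} {τ : M.toStarSubalgebra →ₗ[ℂ] ℂ}

theorem re_nonneg (hτ : IsTraceState M τ) {x : M.toStarSubalgebra}
    (hx : 0 ≤ (x : H →L[ℂ] H)) : 0 ≤ (τ x).re := by
  obtain ⟨s, hs, rfl⟩ := exists_sqrt_mem x hx
  simpa [hs] using hτ.nonneg_re s

theorem im_of_nonneg (hτ : IsTraceState M τ) {x : M.toStarSubalgebra}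
    (hx : 0 ≤ (x : H →L[ℂ] H)) : (τ x).im = 0 := by
  obtain ⟨s, hs, rfl⟩ := exists_sqrt_mem x hx
  simpa [hs] using hτ.im_eq_zero s

theorem re_mul_nonneg (hτ : IsTraceState M τ) {x y : M.toStarSubalgebra}
    (hx : 0 ≤ (x : H →L[ℂ] H)) (hy : 0 ≤ (y : H →L[ℂ] H)) : 0 ≤ (τ (x * y)).re := by
  obtain ⟨s, hs, rfl⟩ := exists_sqrt_mem x hx
  obtain ⟨t, ht, rfl⟩ := exists_sqrt_mem y hy
  have : τ (s * s * (t * t)) = τ (star (s * t) * (s * t)) := by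
    rw [star_mul, hs, ht, mul_assoc, hτ.map_mul_comm]
    simp only [mul_assoc]
    rw [hτ.map_mul_comm]
    simp only [mul_assoc]
    rw [hτ.map_mul_comm]
    simp only [mul_assoc]
  rw [this]
  exact hτ.nonneg_re _

theorem exists_posPart {M : VonNeumannAlgebra H} (a : M.toStarSubalgebra) (ha : star a = a) :
    ∃ p q : M.toStarSubalgebra, 0 ≤ (p : H →L[ℂ] H) ∧ 0 ≤ (q : H →L[ℂ] H) ∧ a = p - q := by
  have hsa : IsSelfAdjoint (a : H →L[ℂ] H) := congrArg Subtype.val ha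
  refine ⟨⟨cfc (fun t : ℝ => max t 0) (a : H →L[ℂ] H), cfc_mem a.2 _⟩,
    ⟨cfc (fun t : ℝ => max (-t) 0) (a : H →L[ℂ] H), cfc_mem a.2 _⟩, ?_, ?_, ?_⟩
  · exact cfc_nonneg fun t _ => le_max_right _ _
  · exact cfc_nonneg fun t _ => le_max_right _ _
  · ext1
    change (a : H →L[ℂ] H) = cfc (fun t : ℝ => max t 0) (a : H →L[ℂ] H) -
      cfc (fun t : ℝ => max (-t) 0) (a : H →L[ℂ] H)
    rw [← cfc_sub (fun t : ℝ => max t 0) (fun t : ℝ => max (-t) 0) (a : H →L[ℂ] H)]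
    conv_lhs => rw [← cfc_id ℝ (a : H →L[ℂ] H)]
    refine cfc_congr fun t _ => ?_
    rcases le_total t 0 with h | h <;> simp [h]

theorem im_of_selfAdjoint (hτ : IsTraceState M τ) {a : M.toStarSubalgebra} (ha : star a = a) :
    (τ a).im = 0 := by
  obtain ⟨p, q, hp, hq, rfl⟩ := exists_posPart a ha
  simp [hτ.im_of_nonneg hp, hτ.im_of_nonneg hq]

theorem im_mul (hτ : IsTraceState M τ) {x b : M.toStarSubalgebra}
    (hx : 0 ≤ (x : H →L[ℂ] H)) (hb : star b = b) : (τ (x * b)).im = 0 := by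
  obtain ⟨s, hs, rfl⟩ := exists_sqrt_mem x hx
  rw [mul_assoc, hτ.map_mul_comm]
  exact hτ.im_of_selfAdjoint (by simp [hs, hb, mul_assoc])

/-- For self-adjoint `a ∈ N` and `0 ≤ x ≤ 1` in `M` there are `0 ≤ h ≤ 1` in `N` with
`τ (x a) ≤ τ (h a) + ε`. -/
theorem exists_le (hτ : IsTraceState M τ) {x a : M.toStarSubalgebra}
    (hx : 0 ≤ (x : H →L[ℂ] H)) (hx1 : (x : H →L[ℂ] H) ≤ 1) (ha : star a = a)
    (haN : (a : H →L[ℂ] H) ∈ N) {ε : ℝ} (hε : 0 < ε) :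
    ∃ h : M.toStarSubalgebra, (h : H →L[ℂ] H) ∈ N ∧ 0 ≤ (h : H →L[ℂ] H) ∧
      (h : H →L[ℂ] H) ≤ 1 ∧ (τ (x * a)).re ≤ (τ (h * a)).re + ε := by
  have hsa : IsSelfAdjoint (a : H →L[ℂ] H) := congrArg Subtype.val ha
  set f : ℝ → ℝ := fun t => max t 0 / (max t 0 + ε) with hf
  have hpos : ∀ t : ℝ, 0 < max t 0 + ε := fun t => by positivity
  have hfc : Continuous f := by
    refine Continuous.div (by fun_prop) (by fun_prop) fun t => (hpos t).ne'
  set p : M.toStarSubalgebra := ⟨cfc (fun t : ℝ => max t 0) (a : H →L[ℂ] H), cfc_mem a.2 _⟩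
  set h : M.toStarSubalgebra := ⟨cfc f (a : H →L[ℂ] H), cfc_mem a.2 _⟩
  have hp : 0 ≤ (p : H →L[ℂ] H) := cfc_nonneg fun t _ => le_max_right _ _
  have hpa : 0 ≤ ((p - a : M.toStarSubalgebra) : H →L[ℂ] H) := by
    change 0 ≤ cfc (fun t : ℝ => max t 0) (a : H →L[ℂ] H) - (a : H →L[ℂ] H)
    rw [sub_nonneg]
    conv_lhs => rw [← cfc_id ℝ (a : H →L[ℂ] H)]
    exact cfc_mono fun t _ => le_max_left _ _
  have h1x : 0 ≤ ((1 - x : M.toStarSubalgebra) : H →L[ℂ] H) := by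
    change 0 ≤ 1 - (x : H →L[ℂ] H)
    exact sub_nonneg.2 hx1
  have hha : 0 ≤ ((h * a - p + (ε : ℂ) • (1 : M.toStarSubalgebra) : M.toStarSubalgebra) :
      H →L[ℂ] H) := by
    have key : cfc (fun t : ℝ => f t * t - max t 0 + ε) (a : H →L[ℂ] H) =
        cfc f (a : H →L[ℂ] H) * (a : H →L[ℂ] H) - cfc (fun t : ℝ => max t 0) (a : H →L[ℂ] H) +
          (ε : ℂ) • (1 : H →L[ℂ] H) := by
      rw [cfc_add (R := ℝ) (a : H →L[ℂ] H) (fun t : ℝ => f t * t - max t 0) (fun _ => ε)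
        (by fun_prop) (by fun_prop),
        cfc_sub (R := ℝ) (fun t : ℝ => f t * t) (fun t : ℝ => max t 0) (a : H →L[ℂ] H)
        (by fun_prop) (by fun_prop),
        cfc_mul (R := ℝ) f (fun t => t) (a : H →L[ℂ] H) (by fun_prop) (by fun_prop),
        cfc_id' ℝ (a : H →L[ℂ] H), cfc_const (R := ℝ) ε (a : H →L[ℂ] H)]
      rfl
    change 0 ≤ cfc f (a : H →L[ℂ] H) * (a : H →L[ℂ] H) -
      cfc (fun t : ℝ => max t 0) (a : H →L[ℂ] H) + (ε : ℂ) • (1 : H →L[ℂ] H)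
    rw [← key]
    refine cfc_nonneg fun t _ => ?_
    rcases le_total t 0 with ht | ht
    · simp [hf, ht, hε.le]
    · have h0 : 0 < t + ε := by positivity
      simp only [hf, max_eq_left ht]
      have : t / (t + ε) * t - t + ε = ε ^ 2 / (t + ε) := by
        field_simp
        ring
      rw [this]
      positivity
  refine ⟨h, cfc_mem haN _, cfc_nonneg fun t _ => ?_, cfc_le_one f _ fun t _ => ?_, ?_⟩
  · have := hpos t
    simp only [hf]
    positivity
  · rw [div_le_one (hpos t)]
    linarith
  · have e1 := hτ.re_mul_nonneg hx hpa
    have e2 := hτ.re_mul_nonneg h1x hp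
    have e3 := hτ.re_nonneg hha
    simp only [mul_sub, sub_mul, one_mul, map_sub, map_add, map_smul, hτ.map_one, Complex.sub_re,
      Complex.add_re, smul_eq_mul, mul_one, Complex.ofReal_re] at e1 e2 e3
    linarith

end IsTraceState

/-- The positive part of the unit ball of `N ⊆ M`. -/
def unitInterval (M N : VonNeumannAlgebra H) : Set M.toStarSubalgebra :=
  {h | (h : H →L[ℂ] H) ∈ N ∧ 0 ≤ (h : H →L[ℂ] H) ∧ (h : H →L[ℂ] H) ≤ 1}

theorem norm_le_one {M N : VonNeumannAlgebra H} {h : M.toStarSubalgebra}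
    (hh : h ∈ unitInterval M N) : ‖(h : H →L[ℂ] H)‖ ≤ 1 :=
  (CStarAlgebra.norm_le_one_iff_of_nonneg _ hh.2.1).2 hh.2.2

theorem summable_norm_mul {G : Type*} [NormedAddCommGroup G] (u v : lp (fun _ : ℕ => G) 2) : Summable fun i => ‖u i‖ * ‖v i‖ :=
  lp.summable_mul (by constructor <;> norm_num) u v

theorem exists_limit {M N : VonNeumannAlgebra H} (hN : N ≤ M)
    (U : Ultrafilter M.toStarSubalgebra) (hU : (U : Filter _) ≤ 𝓟 (unitInterval M N)) :
    ∃ T ∈ unitInterval M N, ∀ u w : H,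
      Tendsto (fun h : M.toStarSubalgebra => inner ℂ ((h : H →L[ℂ] H) u) w) U
        (𝓝 (inner ℂ ((T : H →L[ℂ] H) u) w)) := by
  have hev : ∀ᶠ h in (U : Filter _), h ∈ unitInterval M N := le_principal_iff.1 hU
  have hb : ∀ u w : H, ∀ h ∈ unitInterval M N,
      ‖inner ℂ ((h : H →L[ℂ] H) u) w‖ ≤ ‖u‖ * ‖w‖ := fun u w h hh => by
    refine (norm_inner_le_norm _ _).trans ?_
    gcongr
    exact ((h : H →L[ℂ] H).le_of_opNorm_le (norm_le_one hh) u).trans_eq (one_mul _)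
  have hlim : ∀ u w : H, ∃ l ∈ Metric.closedBall (0 : ℂ) (‖u‖ * ‖w‖),
      Tendsto (fun h : M.toStarSubalgebra => inner ℂ ((h : H →L[ℂ] H) u) w) U (𝓝 l) := by
    intro u w
    obtain ⟨l, hl, hle⟩ := isCompact_iff_ultrafilter_le_nhds.1
      (isCompact_closedBall (0 : ℂ) (‖u‖ * ‖w‖))
      (U.map fun h : M.toStarSubalgebra => inner ℂ ((h : H →L[ℂ] H) u) w) (by
        rw [le_principal_iff]
        change _ ∈ (U : Filter M.toStarSubalgebra)
        filter_upwards [hev] with h hh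
        simpa using hb u w h hh)
    exact ⟨l, hl, hle⟩
  choose L hLb hL using hlim
  let B : H →L⋆[ℂ] H →L[ℂ] ℂ := LinearMap.mkContinuous₂
    (LinearMap.mk₂'ₛₗ (starRingEnd ℂ) (RingHom.id ℂ) L
      (fun a b c => tendsto_nhds_unique (hL _ _) (by
        simpa [inner_add_left] using (hL a c).add (hL b c)))
      (fun r a c => tendsto_nhds_unique (hL _ _) (by
        simpa [inner_smul_left, mul_comm] using (hL a c).const_mul (starRingEnd ℂ r)))
      (fun a b c => tendsto_nhds_unique (hL _ _) (by
        simpa [inner_add_right] using (hL a b).add (hL a c)))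
      (fun r a c => tendsto_nhds_unique (hL _ _) (by
        simpa [inner_smul_right] using (hL a c).const_mul r)))
    1 (fun x y => by simpa using hLb x y)
  set T := InnerProductSpace.continuousLinearMapOfBilin B with hT
  have hTL : ∀ u w, inner ℂ (T u) w = L u w := fun u w => by
    rw [hT, InnerProductSpace.continuousLinearMapOfBilin_apply]
    rfl
  have hTt : ∀ u w : H, Tendsto (fun h : M.toStarSubalgebra => inner ℂ ((h : H →L[ℂ] H) u) w) U
        (𝓝 (inner ℂ (T u) w)) := fun u w => hTL u w ▸ hL u w
  have hTN : T ∈ N := by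
    refine mem_of_forall_commute fun y hy => ?_
    refine ContinuousLinearMap.ext fun u => ext_inner_right ℂ fun w => ?_
    change inner ℂ (T (y u)) w = inner ℂ (y (T u)) w
    rw [← ContinuousLinearMap.adjoint_inner_right y (T u) w]
    refine tendsto_nhds_unique (hTt _ _) ((hTt u _).congr' ?_)
    filter_upwards [hev] with h hh
    rw [ContinuousLinearMap.adjoint_inner_right]
    have := congrArg (fun A : H →L[ℂ] H => A u) (commute_of_mem hh.1 hy).eq
    exact congrArg (fun z => inner ℂ z w) this.symm
  refine ⟨⟨T, hN hTN⟩, ⟨hTN, ?_, ?_⟩, hTt⟩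
  · change 0 ≤ T
    rw [ContinuousLinearMap.nonneg_iff_isPositive, ContinuousLinearMap.isPositive_iff_complex]
    open scoped ComplexOrder in
    have h0 : ∀ u, 0 ≤ inner ℂ (T u) u := fun u => by
      refine ge_of_tendsto (hTt u u) ?_
      filter_upwards [hev] with h hh
      have := ((ContinuousLinearMap.nonneg_iff_isPositive _).1 hh.2.1).inner_nonneg_left u
      exact this
    intro u
    obtain ⟨h1, h2⟩ := Complex.nonneg_iff.1 (h0 u)
    exact ⟨Complex.ext (by simp) (by simpa using h2), h1⟩
  · change T ≤ 1
    rw [ContinuousLinearMap.le_def, ContinuousLinearMap.isPositive_iff_complex]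
    open scoped ComplexOrder in
    have h0 : ∀ u, 0 ≤ inner ℂ ((1 - T) u) u := fun u => by
      have ht : Tendsto (fun h : M.toStarSubalgebra => inner ℂ ((1 - (h : H →L[ℂ] H)) u) u) U
          (𝓝 (inner ℂ ((1 - T) u) u)) := by
        simpa [inner_sub_left] using (hTt u u).const_sub (inner ℂ u u)
      refine ge_of_tendsto ht ?_
      filter_upwards [hev] with h hh
      exact ((ContinuousLinearMap.le_def _ _).1 hh.2.2).inner_nonneg_left u
    intro u
    obtain ⟨h1, h2⟩ := Complex.nonneg_iff.1 (h0 u)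
    exact ⟨Complex.ext (by simp) (by simpa only [Complex.ofReal_im] using h2), h1⟩

theorem isCompact_unitInterval {M N : VonNeumannAlgebra H} (hN : N ≤ M) :
    @IsCompact _ (ultraweakTopology M) (unitInterval M N) := by
  rw [@isCompact_iff_ultrafilter_le_nhds _ (ultraweakTopology M)]
  intro U hU
  obtain ⟨T, hT, hlim⟩ := exists_limit hN U hU
  have hev : ∀ᶠ h in (U : Filter _), h ∈ unitInterval M N := le_principal_iff.1 hU
  refine ⟨T, hT, ?_⟩
  rw [nhds_induced, ← tendsto_iff_comap, tendsto_pi_nhds]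
  rintro ⟨u, v⟩
  refine tendsto_tsum_of_dominated_convergence (summable_norm_mul u v) (fun i => ?_) ?_
  · have := (Complex.continuous_conj.tendsto _).comp (hlim (v i) (u i))
    simpa [Function.comp_def] using this
  · filter_upwards [hev] with h hh i
    refine (norm_inner_le_norm _ _).trans ?_
    gcongr
    exact ((h : H →L[ℂ] H).le_of_opNorm_le (norm_le_one hh) _).trans_eq (one_mul _)

theorem continuous_mul_right (M : VonNeumannAlgebra H) (b : M.toStarSubalgebra) :
    @Continuous _ _ (ultraweakTopology M) (ultraweakTopology M) fun x => x * b := by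
  let _ := ultraweakTopology M
  rw [continuous_induced_rng]
  refine continuous_pi fun p => ?_
  have hmem : Memℓp (fun i => (b : H →L[ℂ] H) (p.2 i)) 2 := by
    refine memℓp_gen ?_
    have hs := ((lp.memℓp p.2).summable (by norm_num)).mul_left
      (‖(b : H →L[ℂ] H)‖ ^ (2 : ENNReal).toReal)
    refine Summable.of_nonneg_of_le (fun i => by positivity) (fun i => ?_) hs
    rw [← Real.mul_rpow (norm_nonneg _) (norm_nonneg _)]
    exact Real.rpow_le_rpow (norm_nonneg _) ((b : H →L[ℂ] H).le_opNorm _) (by norm_num)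
  have hdom := @continuous_induced_dom M.toStarSubalgebra
    (lp (fun _ : ℕ => H) 2 × lp (fun _ : ℕ => H) 2 → ℂ)
    (fun x p => ∑' i, inner ℂ (p.1 i) ((x : H →L[ℂ] H) (p.2 i))) inferInstance
  exact continuous_pi_iff.1 hdom (p.1, (⟨_, hmem⟩ : lp (fun _ : ℕ => H) 2))

theorem unitInterval_combo {M N : VonNeumannAlgebra H} {h k : M.toStarSubalgebra}
    (hh : h ∈ unitInterval M N) (hk : k ∈ unitInterval M N) {s t : ℝ} (hs : 0 ≤ s) (ht : 0 ≤ t)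
    (hst : s + t = 1) : (s : ℂ) • h + (t : ℂ) • k ∈ unitInterval M N := by
  have e : (((s : ℂ) • h + (t : ℂ) • k : M.toStarSubalgebra) : H →L[ℂ] H) =
      s • (h : H →L[ℂ] H) + t • (k : H →L[ℂ] H) := by
    rw [← Complex.coe_smul, ← Complex.coe_smul]
    rfl
  refine ⟨add_mem (N.toStarSubalgebra.smul_mem hh.1 _) (N.toStarSubalgebra.smul_mem hk.1 _), ?_, ?_⟩
  · rw [e]
    exact add_nonneg (smul_nonneg hs hh.2.1) (smul_nonneg ht hk.2.1)
  · rw [e]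
    calc s • (h : H →L[ℂ] H) + t • (k : H →L[ℂ] H) ≤ s • (1 : H →L[ℂ] H) + t • (1 : H →L[ℂ] H) :=
          add_le_add (smul_le_smul_of_nonneg_left hh.2.2 hs)
            (smul_le_smul_of_nonneg_left hk.2.2 ht)
      _ = 1 := by rw [← add_smul, hst, one_smul]

theorem exists_radonNikodym_re {M N : VonNeumannAlgebra H} {τ : M.toStarSubalgebra →ₗ[ℂ] ℂ}
    (hτ : IsTraceState M τ) (hN : N ≤ M) {x : M.toStarSubalgebra}
    (hx : 0 ≤ (x : H →L[ℂ] H)) (hx1 : (x : H →L[ℂ] H) ≤ 1) :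
    ∃ h ∈ unitInterval M N, ∀ b : M.toStarSubalgebra, (b : H →L[ℂ] H) ∈ N → star b = b →
      (τ (h * b)).re = (τ (x * b)).re := by
  classical
  let _ := ultraweakTopology M
  have hcont : ∀ b : M.toStarSubalgebra, Continuous fun h => (τ (h * b)).re := fun b =>
    Complex.continuous_re.comp (hτ.normal.comp (continuous_mul_right M b))
  let S := {b : M.toStarSubalgebra // (b : H →L[ℂ] H) ∈ N ∧ star b = b}
  obtain ⟨h, hh, hh'⟩ := (isCompact_unitInterval hN).inter_iInter_nonempty
    (fun b : S => {h : M.toStarSubalgebra | (τ (h * b.1)).re = (τ (x * b.1)).re})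
    (fun b => isClosed_eq (hcont b.1) continuous_const) (by
      intro u
      let Φ : M.toStarSubalgebra → (u → ℝ) := fun y b => (τ (y * b.1.1)).re
      by_cases hmem : Φ x ∈ Φ '' unitInterval M N
      · obtain ⟨h, hh, he⟩ := hmem
        refine ⟨h, hh, ?_⟩
        simp only [Set.mem_iInter]
        exact fun b hb => congrFun he ⟨b, hb⟩
      exfalso
      have hconv : Convex ℝ (Φ '' unitInterval M N) := by
        rintro _ ⟨h, hh, rfl⟩ _ ⟨k, hk, rfl⟩ s t hs ht hst
        refine ⟨_, unitInterval_combo hh hk hs ht hst, ?_⟩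
        ext b
        simp [Φ, add_mul]
      have hcl : IsClosed (Φ '' unitInterval M N) :=
        ((isCompact_unitInterval hN).image (continuous_pi fun b : u => hcont b.1.1)).isClosed
      obtain ⟨f, r, hf1, hf2⟩ := geometric_hahn_banach_closed_point hconv hcl hmem
      let a : M.toStarSubalgebra := ∑ b : u, ((f (Pi.single b 1) : ℝ) : ℂ) • b.1.1
      have hfa : ∀ y, f (Φ y) = (τ (y * a)).re := by
        intro y
        have := LinearMap.pi_apply_eq_sum_univ f.toLinearMap (Φ y)
        rw [ContinuousLinearMap.coe_coe] at this
        rw [this]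
        simp only [a, Finset.mul_sum, map_sum, Complex.re_sum, mul_smul_comm, map_smul]
        refine Finset.sum_congr rfl fun b _ => ?_
        have hs : (fun j => if b = j then (1 : ℝ) else 0) = Pi.single b 1 := by
          ext j
          simp [Pi.single_apply, eq_comm]
        simp [Φ, mul_comm, hs]
      have haN : (a : H →L[ℂ] H) ∈ N := by
        simp only [a, AddSubmonoidClass.coe_finsetSum]
        exact sum_mem fun b _ => N.toStarSubalgebra.smul_mem b.1.2.1 _
      have ha : star a = a := by
        simp only [a, star_sum, star_smul]
        refine Finset.sum_congr rfl fun b _ => ?_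
        rw [b.1.2.2]
        simp
      obtain ⟨h, h1, h2, h3, h4⟩ := hτ.exists_le hx hx1 ha haN (sub_pos.2 hf2)
      have := hf1 _ ⟨h, ⟨h1, h2, h3⟩, rfl⟩
      rw [hfa] at this h4
      rw [hfa] at hf2
      linarith)
  simp only [Set.mem_iInter] at hh'
  exact ⟨h, hh, fun b hb hb' => hh' ⟨b, hb, hb'⟩⟩

theorem exists_radonNikodym {M N : VonNeumannAlgebra H} {τ : M.toStarSubalgebra →ₗ[ℂ] ℂ}
    (hτ : IsTraceState M τ) (hN : N ≤ M) {x : M.toStarSubalgebra}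
    (hx : 0 ≤ (x : H →L[ℂ] H)) (hx1 : (x : H →L[ℂ] H) ≤ 1) :
    ∃ h ∈ unitInterval M N, ∀ b : M.toStarSubalgebra, (b : H →L[ℂ] H) ∈ N →
      τ (h * b) = τ (x * b) := by
  obtain ⟨h, hh, hre⟩ := exists_radonNikodym_re hτ hN hx hx1
  have hsa : ∀ b : M.toStarSubalgebra, (b : H →L[ℂ] H) ∈ N → star b = b →
      τ (h * b) = τ (x * b) := fun b hb hb' =>
    Complex.ext (hre b hb hb') (by rw [hτ.im_mul hh.2.1 hb', hτ.im_mul hx hb'])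
  refine ⟨h, hh, fun b hb => ?_⟩
  have hbs : star (b : H →L[ℂ] H) ∈ N := star_mem hb
  have h1 := hsa (b + star b) (add_mem hb hbs) (by simp [add_comm])
  have h2 := hsa (Complex.I • (b - star b))
    (N.toStarSubalgebra.smul_mem (sub_mem hb hbs) _) (by simp [smul_sub, neg_add_eq_sub])
  simp only [mul_add, mul_sub, map_add, map_sub, mul_smul_comm, map_smul, smul_eq_mul] at h1 h2
  simp only [← mul_sub] at h2
  have h2 := mul_left_cancel₀ Complex.I_ne_zero h2
  linear_combination (h1 + h2) / 2

/-- Every `x ≥ 0` in `M` has a positive projection on `N`. -/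
theorem exists_proj_of_nonneg {M N : VonNeumannAlgebra H} {τ : M.toStarSubalgebra →ₗ[ℂ] ℂ}
    (hτ : IsTraceState M τ) (hN : N ≤ M) {x : M.toStarSubalgebra}
    (hx : 0 ≤ (x : H →L[ℂ] H)) :
    ∃ y : M.toStarSubalgebra, (y : H →L[ℂ] H) ∈ N ∧ 0 ≤ (y : H →L[ℂ] H) ∧
      ∀ b : M.toStarSubalgebra, (b : H →L[ℂ] H) ∈ N → τ (y * b) = τ (x * b) := by
  set c : ℝ := ‖(x : H →L[ℂ] H)‖ + 1 with hc
  have hc0 : 0 < c := by positivity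
  have e : ∀ (r : ℝ) (z : M.toStarSubalgebra),
      (((r : ℂ) • z : M.toStarSubalgebra) : H →L[ℂ] H) = r • (z : H →L[ℂ] H) := fun r z => by
    rw [← Complex.coe_smul]
    rfl
  obtain ⟨h, hh, hb⟩ := exists_radonNikodym (x := ((c⁻¹ : ℝ) : ℂ) • x) hτ hN
    (by rw [e]; exact smul_nonneg (by positivity) hx) (by
      rw [e, ← CStarAlgebra.norm_le_one_iff_of_nonneg _ (smul_nonneg (by positivity) hx),
        norm_smul, Real.norm_of_nonneg (by positivity), inv_mul_le_one₀ hc0]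
      linarith)
  refine ⟨(c : ℂ) • h, N.toStarSubalgebra.smul_mem hh.1 _, ?_, fun b hbN => ?_⟩
  · rw [e]
    exact smul_nonneg hc0.le hh.2.1
  · have hc' : (c : ℂ) ≠ 0 := by exact_mod_cast hc0.ne'
    rw [smul_mul_assoc, map_smul, hb b hbN, smul_mul_assoc, map_smul, smul_smul]
    simp [hc']

theorem exists_proj {M N : VonNeumannAlgebra H} {τ : M.toStarSubalgebra →ₗ[ℂ] ℂ}
    (hτ : IsTraceState M τ) (hN : N ≤ M) (x : M.toStarSubalgebra) :
    ∃ y : M.toStarSubalgebra, (y : H →L[ℂ] H) ∈ N ∧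
      ∀ b : M.toStarSubalgebra, (b : H →L[ℂ] H) ∈ N → τ (y * b) = τ (x * b) := by
  have hsa : ∀ x : M.toStarSubalgebra, star x = x → ∃ y : M.toStarSubalgebra,
      (y : H →L[ℂ] H) ∈ N ∧
      ∀ b : M.toStarSubalgebra, (b : H →L[ℂ] H) ∈ N → τ (y * b) = τ (x * b) := by
    intro x hx
    obtain ⟨p, q, hp, hq, rfl⟩ := IsTraceState.exists_posPart x hx
    obtain ⟨y, hy, -, hy'⟩ := exists_proj_of_nonneg hτ hN hp
    obtain ⟨z, hz, -, hz'⟩ := exists_proj_of_nonneg hτ hN hq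
    exact ⟨y - z, sub_mem hy hz, fun b hb => by simp [sub_mul, hy' b hb, hz' b hb]⟩
  obtain ⟨y, hy, hy'⟩ := hsa (x + star x) (by simp [add_comm])
  obtain ⟨z, hz, hz'⟩ := hsa (Complex.I • (x - star x)) (by simp [smul_sub, neg_add_eq_sub])
  refine ⟨(1 / 2 : ℂ) • (y + (-Complex.I) • z), N.toStarSubalgebra.smul_mem
    (add_mem hy (N.toStarSubalgebra.smul_mem hz _)) _, fun b hb => ?_⟩
  have h1 := hy' b hb
  have h2 := hz' b hb
  simp only [add_mul, sub_mul, map_add, map_sub, smul_mul_assoc, map_smul, smul_eq_mul] at h1 h2 ⊢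
  rw [h1, h2]
  linear_combination (-(1 / 2) * (τ (x * b) - τ (star x * b))) * Complex.I_sq

theorem proj_unique {M N : VonNeumannAlgebra H} {τ : M.toStarSubalgebra →ₗ[ℂ] ℂ}
    (hτ : IsTraceState M τ) {y z : M.toStarSubalgebra}
    (hy : (y : H →L[ℂ] H) ∈ N) (hz : (z : H →L[ℂ] H) ∈ N)
    (h : ∀ b : M.toStarSubalgebra, (b : H →L[ℂ] H) ∈ N → τ (y * b) = τ (z * b)) : y = z := by
  have hyz : ((y - z : M.toStarSubalgebra) : H →L[ℂ] H) ∈ N := sub_mem hy hz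
  have h0 := h (star (y - z)) (star_mem hyz)
  refine sub_eq_zero.1 (hτ.faithful _ ?_)
  rw [hτ.map_mul_comm, sub_mul, map_sub, h0, sub_self]

/-- The trace-preserving conditional expectation onto a von Neumann subalgebra exists. -/
theorem exists_isCondExp {M N : VonNeumannAlgebra H} {τ : M.toStarSubalgebra →ₗ[ℂ] ℂ}
    (hτ : IsTraceState M τ) (hN : N ≤ M) : ∃ E, IsCondExp M τ N E := by
  choose F hF hF' using exists_proj hτ hN
  have key : ∀ {x y : M.toStarSubalgebra}, (y : H →L[ℂ] H) ∈ N →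
      (∀ b : M.toStarSubalgebra, (b : H →L[ℂ] H) ∈ N → τ (y * b) = τ (x * b)) → F x = y :=
    fun {x y} hy h => proj_unique hτ (hF x) hy fun b hb => by rw [hF' x b hb, h b hb]
  refine ⟨{ toFun := F, map_add' := fun x y => ?_, map_smul' := fun c x => ?_ },
    hF, fun x hx => key hx fun _ _ => rfl, fun a x b ha hb => ?_, fun x hx => ?_, fun x => ?_⟩
  · exact key (add_mem (hF x) (hF y)) fun b hb => by simp [add_mul, hF' _ b hb]
  · exact key (N.toStarSubalgebra.smul_mem (hF x) c) fun b hb => by simp [hF' _ b hb]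
  · refine key (mul_mem (mul_mem ha (hF x)) hb) fun d hd => ?_
    change τ (a * F x * b * d) = τ (a * x * b * d)
    have h1 := hF' x (b * d * a) (mul_mem (mul_mem hb hd) ha)
    calc τ (a * F x * b * d) = τ (F x * (b * d * a)) := by
          rw [mul_assoc (a * F x), mul_assoc a (F x), hτ.map_mul_comm a]
          simp only [mul_assoc]
      _ = τ (x * (b * d * a)) := h1
      _ = τ (a * x * b * d) := by
          rw [mul_assoc (a * x), mul_assoc a x, hτ.map_mul_comm a]
          simp only [mul_assoc]
  · obtain ⟨y, hy, hy0, hy'⟩ := exists_proj_of_nonneg hτ hN hx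
    change 0 ≤ (F x : H →L[ℂ] H)
    rw [key hy hy']
    exact hy0
  · have := hF' x 1 (one_mem N)
    simpa using this

/-- The trace-preserving conditional expectation is unique. -/
theorem IsCondExp.unique {M N : VonNeumannAlgebra H} {τ : M.toStarSubalgebra →ₗ[ℂ] ℂ}
    (hτ : IsTraceState M τ) {E F : M.toStarSubalgebra →ₗ[ℂ] M.toStarSubalgebra}
    (hE : IsCondExp M τ N E) (hF : IsCondExp M τ N F) : E = F := by
  have key : ∀ {G : M.toStarSubalgebra →ₗ[ℂ] M.toStarSubalgebra}, IsCondExp M τ N G →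
      ∀ x b : M.toStarSubalgebra, (b : H →L[ℂ] H) ∈ N → τ (G x * b) = τ (x * b) := by
    intro G hG x b hb
    have := hG.bimodule 1 x b (one_mem N) hb
    simp only [one_mul] at this
    rw [← this, hG.trace_apply]
  exact LinearMap.ext fun x => proj_unique hτ (hE.mem x) (hF.mem x) fun b hb => by
    rw [key hE x b hb, key hF x b hb]

end Existence

/-- The trace-preserving conditional expectation `E : M → M` of `(M, τ)` onto `N ⊆ M`. -/
noncomputable def condExp {M N : VonNeumannAlgebra H} {τ : M.toStarSubalgebra →ₗ[ℂ] ℂ}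
    (hτ : IsTraceState M τ) (hN : N ≤ M) : M.toStarSubalgebra →ₗ[ℂ] M.toStarSubalgebra :=
  (exists_isCondExp hτ hN).choose

theorem isCondExp_condExp {M N : VonNeumannAlgebra H} {τ : M.toStarSubalgebra →ₗ[ℂ] ℂ}
    (hτ : IsTraceState M τ) (hN : N ≤ M) : IsCondExp M τ N (condExp hτ hN) :=
  (exists_isCondExp hτ hN).choose_spec


/-- The von Neumann subalgebra of `M` generated by `1, T₁, …, Tₙ`. -/
noncomputable def generatedBy {M : VonNeumannAlgebra H} {n : ℕ} (T : Fin n → M.toStarSubalgebra) :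
    VonNeumannAlgebra H :=
  vonNeumannGenerated (insert 1 (Set.range fun j => (T j : H →L[ℂ] H)))

theorem generatedBy_le {M : VonNeumannAlgebra H} {n : ℕ} (T : Fin n → M.toStarSubalgebra) :
    generatedBy T ≤ M :=
  vonNeumannGenerated_le (Set.insert_subset (one_mem M) (Set.range_subset_iff.2 fun j => (T j).2))

/-- The orthogonal, in the real space of `n`-tuples of self-adjoint elements of `N ⊆ M`, of the
cyclic gradients `δP(T) = ((δ_j P)(T₁, …, Tₙ))_j`, `P ∈ ℂ⟨X₁, …, Xₙ⟩`, for the scalar product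
`⟨a, b⟩ = ∑ j, τ (a_j b_j*)`. -/
def cyclicGradientOrthogonal {M : VonNeumannAlgebra H} (τ : M.toStarSubalgebra →ₗ[ℂ] ℂ)
    (N : VonNeumannAlgebra H) {n : ℕ} (T : Fin n → M.toStarSubalgebra) :
    Set (Fin n → M.toStarSubalgebra) :=
  {ζ | (∀ j, (ζ j : H →L[ℂ] H) ∈ N ∧ IsSelfAdjoint (ζ j)) ∧
    ∀ P : FreeAlgebra ℂ (Fin n),
      ∑ j, τ (ζ j * star (FreeAlgebra.lift ℂ T (cyclicDeriv j P))) = 0}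

end VonNeumann

end CyclicGrad

/-!
For a trace `τ` the pairing `τ (∑ j, ξ j * δ_j P (T))` is the derivative at `ε = 0` of
`τ (P (T + ε ξ))`, that is, the `ε`-part of the moment `τ (P (T + ε ξ))` computed over the dual
numbers `M[ε]`, `ε² = 0` (`epsilonPart_lift_perturb`). The hypothesis on `ξ` therefore says that
`Z + ε ξ` has the same moments as `Z`, and the claim is that `Y + Z + ε ξ` has the same moments as
`Y + Z`.

If `Y` is independent or free from `Z + ε ξ` over the dual numbers, the moments of `Y + Z + ε ξ` are
determined by those of `Y` and those of `Z + ε ξ`, so they have no `ε`-part. Concretely, the algebra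
generated by `Y` and `Z + ε ξ` is spanned by products `a b` (in the independent case) or by
alternating words of centered letters (in the free case), and the `ε`-part of `τ` vanishes on these
by the Leibniz rule (`epsilonPart_lift_perturb_add`).

This uses independence or freeness with one letter taken from the von Neumann algebra `W_Z` in place
of `ℂ⟨Z⟩`. As that letter enters linearly, it suffices that an ultraweakly continuous functional
vanishing on `ℂ⟨Z⟩` vanishes on `W_Z` (`eq_zero_of_mem_generatedBy`). This is the density part of
the bicommutant theorem: such a functional is `x ↦ ⟪u, (x ⊗ 1) v⟫` on `H ⊗ ℓ²`, and the projection
onto the orthogonal complement of `(ℂ⟨Z⟩ ⊗ 1) v` commutes with `x ⊗ 1`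
(`inner_amplification_eq_zero`).

The statement on conditional expectations follows from `τ (E x * b) = τ (x * b)` for `b` in the
range of `E`, and from `τ (x*)` being the conjugate of `τ x`.
-/

namespace CyclicGrad

/-! ### Amplifications and bicommutants -/

section Amplification

open scoped ENNReal

variable {H : Type*} [NormedAddCommGroup H] [InnerProductSpace ℂ H] {ι : Type*}

theorem memℓp_apply (T : H →L[ℂ] H) (f : lp (fun _ : ι => H) 2) :
    Memℓp (fun i => T (f i)) 2 :=
  ((lp.memℓp f).const_smul (‖T‖ : ℂ)).mono' fun i => by
    simpa [norm_smul] using T.le_opNorm (f i)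

/-- The amplification `T ⊗ 1` of a bounded operator `T` on `H` to `ℓ²(ι, H) = H ⊗ ℓ²(ι)`,
acting coordinatewise. -/
noncomputable def amplification (T : H →L[ℂ] H) :
    lp (fun _ : ι => H) 2 →L[ℂ] lp (fun _ : ι => H) 2 :=
  LinearMap.mkContinuous
    { toFun := fun f => ⟨fun i => T (f i), memℓp_apply T f⟩
      map_add' := fun f g => by ext i; exact map_add T _ _
      map_smul' := fun c f => by ext i; exact map_smul T _ _ }
    ‖T‖ fun f => by
      have h := lp.norm_mono (p := 2) (by norm_num)
        (x := (⟨fun i => T (f i), memℓp_apply T f⟩ : lp (fun _ : ι => H) 2))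
        (y := (‖T‖ : ℂ) • f) fun i => by
          change ‖T (f i)‖ ≤ ‖(‖T‖ : ℂ) • f i‖
          simpa [norm_smul] using T.le_opNorm (f i)
      refine h.trans_eq ?_
      rw [norm_smul]
      simp

@[simp]
theorem amplification_apply (T : H →L[ℂ] H) (f : lp (fun _ : ι => H) 2) (i : ι) :
    amplification T f i = T (f i) := rfl

theorem amplification_mul_apply (S T : H →L[ℂ] H) (f : lp (fun _ : ι => H) 2) :
    amplification (S * T) f = amplification S (amplification T f) := rfl

theorem amplification_one_apply (f : lp (fun _ : ι => H) 2) : amplification 1 f = f := rfl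

theorem amplification_single [DecidableEq ι] (T : H →L[ℂ] H) (i : ι) (x : H) :
    amplification T (lp.single 2 i x : lp (fun _ : ι => H) 2) = lp.single 2 i (T x) := by
  ext j
  rw [amplification_apply]
  by_cases hj : j = i
  · subst hj
    simp
  · rw [lp.single_apply_ne _ _ _ hj, lp.single_apply_ne _ _ _ hj, map_zero]

theorem inner_amplification [CompleteSpace H] (T : H →L[ℂ] H) (f g : lp (fun _ : ι => H) 2) :
    inner ℂ f (amplification T g) = inner ℂ (amplification (star T) f) g := by
  rw [lp.inner_eq_tsum, lp.inner_eq_tsum]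
  refine tsum_congr fun i => ?_
  rw [amplification_apply, amplification_apply, ContinuousLinearMap.star_eq_adjoint,
    ContinuousLinearMap.adjoint_inner_left]

/-- The amplification `x ⊗ 1` of an operator `x` in the bicommutant of `B` lies in the bicommutant
of the amplification of `B`: the matrix entries of an operator commuting with `B ⊗ 1` commute
with `B`. -/
theorem amplification_commute {B : Set (H →L[ℂ] H)} {x : H →L[ℂ] H}
    (hx : ∀ y : H →L[ℂ] H, (∀ b ∈ B, Commute b y) → Commute x y)
    (P : lp (fun _ : ι => H) 2 →L[ℂ] lp (fun _ : ι => H) 2)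
    (hP : ∀ b ∈ B, ∀ f, P (amplification b f) = amplification b (P f))
    (f : lp (fun _ : ι => H) 2) : P (amplification x f) = amplification x (P f) := by
  classical
  have hsingle : ∀ (j : ι) (h : H), P (amplification x (lp.single 2 j h)) =
      amplification x (P (lp.single 2 j h)) := by
    intro j h
    ext i
    -- the `(i, j)` entry of `P`
    let T : H →L[ℂ] H := (lp.evalCLM ℂ (fun _ : ι => H) 2 i).comp
      (P.comp (lp.singleContinuousLinearMap ℂ (fun _ : ι => H) 2 j))
    have hT : ∀ k, T k = P (lp.single 2 j k) i := fun k => rfl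
    have hc : Commute x T := hx T fun b hb => by
      ext k
      change b (P (lp.single 2 j k) i) = P (lp.single 2 j (b k)) i
      rw [← amplification_single, hP b hb]
      rfl
    have := congrArg (fun S : H →L[ℂ] H => S h) hc.eq
    change x (T h) = T (x h) at this
    rw [hT, hT] at this
    rw [amplification_single, amplification_apply, this]
  have hs := lp.hasSum_single (p := 2) (by norm_num) f
  have h1 := (hs.mapL (amplification x)).mapL P
  have h2 := (hs.mapL P).mapL (amplification x)
  simp only [hsingle] at h1
  exact h1.unique h2

/-- A functional `x ↦ ∑ i, ⟪u i, x (v i)⟫` that vanishes on a unital self-adjoint algebra `B` of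
operators vanishes on the bicommutant of `B`. The projection onto the orthogonal complement of
`(B ⊗ 1) v` commutes with `B ⊗ 1`, hence with `x ⊗ 1`; it fixes `u` and kills `v`. -/
theorem inner_amplification_eq_zero [CompleteSpace H] {B : Subalgebra ℂ (H →L[ℂ] H)}
    (hB : ∀ b ∈ B, star b ∈ B) (u v : lp (fun _ : ι => H) 2)
    (huv : ∀ b ∈ B, inner ℂ u (amplification b v) = 0) {x : H →L[ℂ] H}
    (hx : ∀ y : H →L[ℂ] H, (∀ b ∈ B, Commute b y) → Commute x y) :
    inner ℂ u (amplification x v) = 0 := by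
  set K : Submodule ℂ (lp (fun _ : ι => H) 2) :=
    (Submodule.span ℂ ((fun b => amplification b v) '' (B : Set (H →L[ℂ] H))))ᗮ with hK
  have hmem : ∀ g, g ∈ K ↔ ∀ b ∈ B, inner ℂ (amplification b v) g = 0 := by
    intro g
    rw [hK, Submodule.mem_orthogonal]
    refine ⟨fun h b hb => h _ (Submodule.subset_span ⟨b, hb, rfl⟩), fun h w hw => ?_⟩
    induction hw using Submodule.span_induction with
    | mem w hw =>
      obtain ⟨b, hb, rfl⟩ := hw
      exact h b hb
    | zero => exact inner_zero_left _
    | add w w' _ _ h1 h2 => rw [inner_add_left, h1, h2, add_zero]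
    | smul c w _ h1 => rw [inner_smul_left, h1, mul_zero]
  have hinv : ∀ b ∈ B, ∀ g ∈ K, amplification b g ∈ K := by
    intro b hb g hg
    rw [hmem] at hg ⊢
    intro b' hb'
    rw [inner_amplification, ← amplification_mul_apply]
    exact hg _ (mul_mem (hB b hb) hb')
  have hcomm : ∀ b ∈ B, ∀ f, K.starProjection (amplification b f) =
      amplification b (K.starProjection f) := by
    intro b hb f
    refine (Submodule.eq_starProjection_of_mem_orthogonal
      (hinv b hb _ (K.starProjection_apply_mem f)) ?_)
    rw [← map_sub, Submodule.mem_orthogonal]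
    intro g hg
    rw [inner_amplification]
    exact (Submodule.mem_orthogonal _ _).1 (K.sub_starProjection_mem_orthogonal f) _
      (hinv _ (hB b hb) g hg)
  have hu : u ∈ K := (hmem u).2 fun b hb => by
    rw [← inner_conj_symm, huv b hb, map_zero]
  have hv : K.starProjection v = 0 := by
    rw [Submodule.starProjection_apply_eq_zero_iff, Submodule.mem_orthogonal]
    intro g hg
    rw [← inner_conj_symm]
    have := (hmem g).1 hg 1 (one_mem B)
    rw [amplification_one_apply] at this
    rw [this, map_zero]
  have h := amplification_commute (B := (B : Set (H →L[ℂ] H))) hx K.starProjection hcomm v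
  rw [hv, map_zero] at h
  exact (Submodule.mem_orthogonal _ _).1 ((Submodule.starProjection_apply_eq_zero_iff K).1 h) u hu

end Amplification

/-! ### Ultraweakly continuous functionals -/

section Normal

universe u

variable {H : Type u} [NormedAddCommGroup H] [InnerProductSpace ℂ H] [CompleteSpace H]

/-- The elementary normal functional `x ↦ ∑ i, ⟪u i, x (v i)⟫` on `M`. -/
noncomputable def vectorFunctional (M : VonNeumannAlgebra H)
    (p : lp (fun _ : ℕ => H) 2 × lp (fun _ : ℕ => H) 2) : M.toStarSubalgebra →ₗ[ℂ] ℂ where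
  toFun x := inner ℂ p.1 (amplification (x : H →L[ℂ] H) p.2)
  map_add' x y := by
    rw [← inner_add_right]
    rfl
  map_smul' c x := by
    rw [RingHom.id_apply, smul_eq_mul, ← inner_smul_right]
    rfl

/-- Every ultraweakly continuous linear functional on `M` is a single vector functional of an
amplification: finitely many pairs of `ℓ²`-sequences are glued to one pair. -/
theorem exists_eq_inner_amplification {M : VonNeumannAlgebra H} {φ : M.toStarSubalgebra →ₗ[ℂ] ℂ}
    (hφ : @Continuous _ _ (ultraweakTopology M) _ φ) :
    ∃ (ι : Type u) (u v : lp (fun _ : ι => H) 2),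
      ∀ x : M.toStarSubalgebra, φ x = inner ℂ u (amplification (x : H →L[ℂ] H) v) := by
  classical
  have hspan : φ ∈ Submodule.span ℂ (Set.range (vectorFunctional M)) := by
    rw [LinearMap.mem_span_iff_continuous]
    have e : ultraweakTopology M =
        ⨅ p, TopologicalSpace.induced (vectorFunctional M p) inferInstance := by
      rw [ultraweakTopology, Pi.topologicalSpace, induced_iInf]
      refine iInf_congr fun p => ?_
      rw [induced_compose]
      rfl
    rw [← e]
    exact hφ
  obtain ⟨c, rfl⟩ := (Finsupp.mem_span_range_iff_exists_finsupp).1 hspan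
  have hmem : ∀ w : c.support → lp (fun _ : ℕ => H) 2,
      Memℓp (fun q : c.support × ℕ => w q.1 q.2) 2 := by
    intro w
    refine memℓp_gen ?_
    rw [summable_prod_of_nonneg fun q => by positivity]
    exact ⟨fun p => (lp.memℓp (w p)).summable (by norm_num), (hasSum_fintype _).summable⟩
  refine ⟨c.support × ℕ,
    ⟨_, hmem fun p => (starRingEnd ℂ (c p)) • p.1.1⟩, ⟨_, hmem fun p => p.1.2⟩, fun x => ?_⟩
  rw [lp.inner_eq_tsum, (lp.summable_inner (𝕜 := ℂ) _ _).tsum_prod, tsum_fintype,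
    Finsupp.sum, LinearMap.sum_apply, ← Finset.sum_coe_sort]
  refine Finset.sum_congr rfl fun p _ => ?_
  rw [LinearMap.smul_apply, smul_eq_mul]
  change c p * inner ℂ p.1.1 (amplification (x : H →L[ℂ] H) p.1.2) = _
  rw [lp.inner_eq_tsum, ← tsum_mul_left]
  refine tsum_congr fun i => ?_
  change _ = inner ℂ ((starRingEnd ℂ (c p)) • p.1.1 i) ((x : H →L[ℂ] H) (p.1.2 i))
  rw [inner_smul_left, Complex.conj_conj]
  rfl

theorem IsTraceState.continuous_apply_mul {M : VonNeumannAlgebra H}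
    {τ : M.toStarSubalgebra →ₗ[ℂ] ℂ} (hτ : IsTraceState M τ) (c : M.toStarSubalgebra) :
    @Continuous _ _ (ultraweakTopology M) _ (τ ∘ₗ LinearMap.mulRight ℂ c) :=
  let _ := ultraweakTopology M
  hτ.normal.comp (continuous_mul_right M c)

theorem star_mem_adjoin_range {A : Type*} [Ring A] [StarRing A] [Algebra ℂ A] [StarModule ℂ A]
    {n : ℕ} {Z : Fin n → A} (hZ : ∀ j, IsSelfAdjoint (Z j)) {b : A}
    (hb : b ∈ Algebra.adjoin ℂ (Set.range Z)) : star b ∈ Algebra.adjoin ℂ (Set.range Z) := by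
  induction hb using Algebra.adjoin_induction with
  | mem x hx =>
    obtain ⟨j, rfl⟩ := hx
    rw [(hZ j).star_eq]
    exact Algebra.subset_adjoin ⟨j, rfl⟩
  | algebraMap r =>
    rw [← algebraMap_star_comm]
    exact Subalgebra.algebraMap_mem _ _
  | add x y _ _ hx hy => rw [star_add]; exact add_mem hx hy
  | mul x y _ _ hx hy => rw [star_mul]; exact mul_mem hy hx

theorem commute_of_mem_generatedBy {M : VonNeumannAlgebra H} {n : ℕ}
    {Z : Fin n → M.toStarSubalgebra} (hZ : ∀ j, IsSelfAdjoint (Z j)) {x y : H →L[ℂ] H}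
    (hx : x ∈ generatedBy Z) (hy : ∀ j, Commute (Z j : H →L[ℂ] H) y) : Commute x y := by
  change x ∈ StarSubalgebra.centralizer ℂ (StarSubalgebra.centralizer ℂ
    (insert 1 (Set.range fun j => (Z j : H →L[ℂ] H))) : Set (H →L[ℂ] H)) at hx
  rw [StarSubalgebra.mem_centralizer_iff] at hx
  refine ((hx y ?_).1).symm
  rw [SetLike.mem_coe, StarSubalgebra.mem_centralizer_iff]
  rintro _ (rfl | ⟨j, rfl⟩)
  · simp
  · have : star (Z j : H →L[ℂ] H) = Z j := congrArg Subtype.val (hZ j).star_eq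
    dsimp only
    rw [this]
    exact ⟨(hy j).eq, (hy j).eq⟩

/-- An ultraweakly continuous functional that vanishes on the algebra generated by self-adjoint
elements `Z₁, …, Zₙ` vanishes on the von Neumann algebra they generate. -/
theorem eq_zero_of_mem_generatedBy {M : VonNeumannAlgebra H} {φ : M.toStarSubalgebra →ₗ[ℂ] ℂ}
    (hφ : @Continuous _ _ (ultraweakTopology M) _ φ) {n : ℕ} {Z : Fin n → M.toStarSubalgebra}
    (hZ : ∀ j, IsSelfAdjoint (Z j)) (h : ∀ b ∈ Algebra.adjoin ℂ (Set.range Z), φ b = 0)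
    {x : M.toStarSubalgebra} (hx : (x : H →L[ℂ] H) ∈ generatedBy Z) : φ x = 0 := by
  obtain ⟨ι, u, v, huv⟩ := exists_eq_inner_amplification hφ
  rw [huv]
  refine inner_amplification_eq_zero
    (B := (Algebra.adjoin ℂ (Set.range Z)).map M.toStarSubalgebra.subtype.toAlgHom) ?_ u v ?_ ?_
  · rintro _ ⟨b, hb, rfl⟩
    exact ⟨star b, star_mem_adjoin_range hZ hb, rfl⟩
  · rintro _ ⟨b, hb, rfl⟩
    exact (huv b).symm.trans (h b hb)
  · exact fun y hy => commute_of_mem_generatedBy hZ hx fun j =>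
      hy _ ⟨Z j, Algebra.subset_adjoin ⟨j, rfl⟩, rfl⟩

end Normal

/-! ### Cyclic gradients and dual numbers -/

section DualNumbers

variable {A : Type*} [Ring A] {n : ℕ}

/-- The first-order perturbation `T + ε ξ` of a tuple `T` in the direction `ξ`, a tuple over the
dual numbers `A[ε]`, `ε² = 0`. -/
def perturb (T ξ : Fin n → A) (j : Fin n) : DualNumber A :=
  TrivSqZeroExt.inl (T j) + TrivSqZeroExt.inr (ξ j)

@[simp]
theorem fst_perturb (T ξ : Fin n → A) (j : Fin n) : (perturb T ξ j).fst = T j := by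
  simp [perturb]

@[simp]
theorem snd_perturb (T ξ : Fin n → A) (j : Fin n) : (perturb T ξ j).snd = ξ j := by
  simp [perturb]

theorem snd_mul_eq (x y : DualNumber A) : (x * y).snd = x.fst * y.snd + x.snd * y.fst := by
  rw [TrivSqZeroExt.snd_mul, smul_eq_mul, MulOpposite.smul_eq_mul_unop, MulOpposite.unop_op]

theorem fst_list_prod_map_perturb (T ξ : Fin n → A) (w : List (Fin n)) :
    ((w.map (perturb T ξ)).prod).fst = (w.map T).prod := by
  rw [TrivSqZeroExt.fst_list_prod, List.map_map]
  congr 2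
  ext j
  simp

theorem snd_list_prod_map_perturb (T ξ : Fin n → A) (w : List (Fin n)) :
    ((w.map (perturb T ξ)).prod).snd = ∑ k : Fin w.length,
      ((w.take k).map T).prod * (ξ (w.get k) * ((w.drop (k + 1)).map T).prod) := by
  induction w with
  | nil => simp
  | cons i w ih =>
    rw [List.map_cons, List.prod_cons, snd_mul_eq, ih, fst_list_prod_map_perturb]
    change _ = ∑ k : Fin (w.length + 1), _
    rw [Fin.sum_univ_succ, add_comm]
    simp [Finset.mul_sum, mul_assoc]

variable [Algebra ℂ A]

/-- The value of a functional `τ` at the `ε`-part of a dual number. At `P (T + ε ξ)` it is the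
derivative of `τ (P (T))` in the direction `ξ`. -/
def epsilonPart (τ : A →ₗ[ℂ] ℂ) : DualNumber A →ₗ[ℂ] ℂ where
  toFun x := τ x.snd
  map_add' x y := by rw [TrivSqZeroExt.snd_add, map_add]
  map_smul' c x := by rw [TrivSqZeroExt.snd_smul, map_smul, RingHom.id_apply]

theorem epsilonPart_apply (τ : A →ₗ[ℂ] ℂ) (x : DualNumber A) : epsilonPart τ x = τ x.snd := rfl

theorem lift_monomial {R : Type*} [Ring R] [Algebra ℂ R] (T : Fin n → R) (w : List (Fin n)) :
    FreeAlgebra.lift ℂ T (monomial w) = (w.map T).prod := by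
  rw [monomial, map_list_prod, List.map_map]
  congr 2
  ext j
  simp

theorem basisFreeMonoid_apply (w : FreeMonoid (Fin n)) :
    FreeAlgebra.basisFreeMonoid ℂ (Fin n) w = monomial (FreeMonoid.toList w) := by
  rw [FreeAlgebra.basisFreeMonoid, Module.Basis.map_apply]
  change MonoidAlgebra.lift ℂ (FreeAlgebra ℂ (Fin n)) (FreeMonoid (Fin n))
    (FreeMonoid.lift (FreeAlgebra.ι ℂ)) (MonoidAlgebra.single w 1) = _
  rw [MonoidAlgebra.lift_single, one_smul, FreeMonoid.lift_apply, monomial]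

theorem cyclicDeriv_monomial (j : Fin n) (w : List (Fin n)) :
    cyclicDeriv j (monomial w) = cyclicDerivMonomial j w := by
  have := (FreeAlgebra.basisFreeMonoid ℂ (Fin n)).constr_basis ℂ
    (fun w => cyclicDerivMonomial j (FreeMonoid.toList w)) (FreeMonoid.ofList w)
  rwa [basisFreeMonoid_apply, FreeMonoid.toList_ofList] at this

/-- For a trace `τ`, the derivative of `τ (P (T))` in the direction `ξ` is the pairing of `ξ` with
the cyclic gradient of `P` at `T`. -/
theorem epsilonPart_lift_perturb {τ : A →ₗ[ℂ] ℂ} (hτ : ∀ x y, τ (x * y) = τ (y * x))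
    (T ξ : Fin n → A) (P : FreeAlgebra ℂ (Fin n)) :
    epsilonPart τ (FreeAlgebra.lift ℂ (perturb T ξ) P) =
      τ (∑ j, ξ j * FreeAlgebra.lift ℂ T (cyclicDeriv j P)) := by
  let f : FreeAlgebra ℂ (Fin n) →ₗ[ℂ] ℂ :=
    epsilonPart τ ∘ₗ (FreeAlgebra.lift ℂ (perturb T ξ)).toLinearMap
  let g : FreeAlgebra ℂ (Fin n) →ₗ[ℂ] ℂ :=
    τ ∘ₗ ∑ j, LinearMap.mulLeft ℂ (ξ j) ∘ₗ (FreeAlgebra.lift ℂ T).toLinearMap ∘ₗ cyclicDeriv j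
  have hg : ∀ P, g P = τ (∑ j, ξ j * FreeAlgebra.lift ℂ T (cyclicDeriv j P)) := fun P => by
    simp [g]
  suffices f = g by rw [← hg, ← this]; rfl
  refine (FreeAlgebra.basisFreeMonoid ℂ (Fin n)).ext fun w => ?_
  rw [basisFreeMonoid_apply, hg]
  generalize FreeMonoid.toList w = w
  change τ (FreeAlgebra.lift ℂ (perturb T ξ) (monomial w)).snd = _
  simp only [lift_monomial, snd_list_prod_map_perturb, cyclicDeriv_monomial, cyclicDerivMonomial,
    map_sum, Finset.mul_sum]
  rw [Finset.sum_comm]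
  refine Finset.sum_congr rfl fun k _ => ?_
  rw [Finset.sum_eq_single (w.get k) (fun j _ hj => by rw [if_neg hj.symm]; simp) (by simp),
    if_pos rfl, lift_monomial, List.map_append, List.prod_append, hτ, mul_assoc]

end DualNumbers

/-! ### Alternating words of free algebras -/

section FreeWords

variable {A : Type*} [Ring A] [Algebra ℂ A] {ι : Type*}

/-- Freeness in terms of lists: `τ` vanishes on every nonempty alternating word of centered
letters. A letter `(i, a)` is an element `a` together with the index of the algebra it is taken
from. -/
theorem FreelyIndependent.apply_list_prod {τ : A →ₗ[ℂ] ℂ} {B : ι → Subalgebra ℂ A}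
    (h : FreelyIndependent τ B) {l : List (ι × A)} (hne : l ≠ [])
    (hchain : (l.map Prod.fst).IsChain (· ≠ ·)) (hmem : ∀ p ∈ l, p.2 ∈ B p.1)
    (hcent : ∀ p ∈ l, τ p.2 = 0) : τ (l.map Prod.snd).prod = 0 := by
  obtain ⟨p, t, rfl⟩ := List.exists_cons_of_ne_nil hne
  let f : Fin (t.length + 1) → ι × A := (p :: t).get
  have hf : p :: t = List.ofFn f := (List.ofFn_get (p :: t)).symm
  have hfm : ∀ k, f k ∈ p :: t := fun k => List.get_mem _ _
  rw [hf, List.map_ofFn]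
  refine h t.length (fun k => (f k).1) (fun k => (f k).2) (fun k => ?_)
    (fun k => hmem _ (hfm k)) (fun k => hcent _ (hfm k))
  rw [List.isChain_map, List.isChain_iff_getElem] at hchain
  exact hchain k (by simp)

/-- The elements `x` that are orthogonal to every `c` orthogonal to the algebra `B`, for the
bilinear form `τ (x c)`: an algebraic substitute for the closure of `B`. -/
def traceClosure (τ : A →ₗ[ℂ] ℂ) (B : Subalgebra ℂ A) : Submodule ℂ A where
  carrier := {x | ∀ c, (∀ b ∈ B, τ (b * c) = 0) → τ (x * c) = 0}
  zero_mem' c _ := by rw [zero_mul, map_zero]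
  add_mem' hx hy c hc := by rw [add_mul, map_add, hx c hc, hy c hc, add_zero]
  smul_mem' r x hx c hc := by rw [smul_mul_assoc, map_smul, hx c hc, smul_zero]

theorem mem_traceClosure {τ : A →ₗ[ℂ] ℂ} {B : Subalgebra ℂ A} {x : A} :
    x ∈ traceClosure τ B ↔ ∀ c, (∀ b ∈ B, τ (b * c) = 0) → τ (x * c) = 0 := Iff.rfl

/-- In an alternating word of centered letters, one letter may be taken from the closure of its
algebra and the trace still vanishes. -/
theorem FreelyIndependent.apply_mul_mul {τ : A →ₗ[ℂ] ℂ} (hτ1 : τ 1 = 1)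
    (hτ : ∀ x y, τ (x * y) = τ (y * x)) {B : ι → Subalgebra ℂ A} (h : FreelyIndependent τ B)
    {l₁ l₂ : List (ι × A)} {i : ι} {x : A} (hx : x ∈ traceClosure τ (B i)) (hx0 : τ x = 0)
    (hchain : (l₁.map Prod.fst ++ i :: l₂.map Prod.fst).IsChain (· ≠ ·))
    (hmem : ∀ p ∈ l₁ ++ l₂, p.2 ∈ B p.1) (hcent : ∀ p ∈ l₁ ++ l₂, τ p.2 = 0) :
    τ ((l₁.map Prod.snd).prod * (x * (l₂.map Prod.snd).prod)) = 0 := by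
  set u := (l₁.map Prod.snd).prod with hu
  set v := (l₂.map Prod.snd).prod with hv
  have key := mem_traceClosure.1 hx (v * u - algebraMap ℂ A (τ (v * u))) fun b hb => by
    have hw := h.apply_list_prod (l := l₁ ++ (i, b - algebraMap ℂ A (τ b)) :: l₂) (by simp)
      (by simpa using hchain)
      (by
        intro p hp
        rw [List.mem_append, List.mem_cons] at hp
        rcases hp with hp | rfl | hp
        · exact hmem p (List.mem_append_left _ hp)
        · exact sub_mem hb (Subalgebra.algebraMap_mem _ _)
        · exact hmem p (List.mem_append_right _ hp))
      (by
        intro p hp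
        rw [List.mem_append, List.mem_cons] at hp
        rcases hp with hp | rfl | hp
        · exact hcent p (List.mem_append_left _ hp)
        · simp [Algebra.algebraMap_eq_smul_one, hτ1]
        · exact hcent p (List.mem_append_right _ hp))
    rw [List.map_append, List.map_cons, List.prod_append, List.prod_cons, ← hu, ← hv, hτ] at hw
    simp only [Algebra.algebraMap_eq_smul_one, sub_mul, mul_sub, mul_assoc, smul_mul_assoc,
      mul_smul_comm, one_mul, mul_one, map_sub, map_smul, smul_eq_mul] at hw ⊢
    rw [mul_comm (τ (v * u))]
    exact hw
  -- the complement of `x` in the word, moved around cyclically, is tested after centering it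
  rw [hτ, mul_assoc]
  simpa [Algebra.algebraMap_eq_smul_one, mul_sub, hx0] using key

end FreeWords

section DualWords

open TrivSqZeroExt

variable {A : Type*} [Ring A] [Algebra ℂ A] {ι : Type*}

/-- The `ε`-part of an alternating word of centered letters over the dual numbers has trace zero:
by the Leibniz rule it is a sum of alternating words with a single letter in a closure. The word
`u` without `ε`-parts stands in front to make the induction work. -/
theorem FreelyIndependent.apply_mul_snd_list_prod {τ : A →ₗ[ℂ] ℂ} (hτ1 : τ 1 = 1)
    (hτ : ∀ x y, τ (x * y) = τ (y * x)) {B : ι → Subalgebra ℂ A} (h : FreelyIndependent τ B)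
    (l : List (ι × DualNumber A)) (u : List (ι × A))
    (hchain : (u.map Prod.fst ++ l.map Prod.fst).IsChain (· ≠ ·))
    (hu : ∀ p ∈ u, p.2 ∈ B p.1 ∧ τ p.2 = 0)
    (hl : ∀ p ∈ l, (p.2.fst ∈ B p.1 ∧ τ p.2.fst = 0) ∧
      p.2.snd ∈ traceClosure τ (B p.1) ∧ τ p.2.snd = 0) :
    τ ((u.map Prod.snd).prod * ((l.map Prod.snd).prod).snd) = 0 := by
  induction l generalizing u with
  | nil => simp
  | cons p l ih =>
    obtain ⟨i, x⟩ := p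
    have hx := hl _ List.mem_cons_self
    have hl' := fun p hp => hl p (List.mem_cons_of_mem _ hp)
    rw [List.map_cons, List.prod_cons, snd_mul_eq, mul_add, map_add]
    have h1 := ih (u ++ [(i, x.fst)]) (by simpa using hchain)
      (by
        intro p hp
        rw [List.mem_append, List.mem_singleton] at hp
        rcases hp with hp | rfl
        · exact hu p hp
        · exact hx.1) hl'
    have h2 := h.apply_mul_mul hτ1 hτ (l₁ := u) (i := i) (l₂ := l.map fun p => (p.1, p.2.fst))
      hx.2.1 hx.2.2 (by simpa [Function.comp_def] using hchain)
      (by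
        intro p hp
        rw [List.mem_append, List.mem_map] at hp
        rcases hp with hp | ⟨q, hq, rfl⟩
        · exact (hu p hp).1
        · exact (hl' q hq).1.1)
      (by
        intro p hp
        rw [List.mem_append, List.mem_map] at hp
        rcases hp with hp | ⟨q, hq, rfl⟩
        · exact (hu p hp).2
        · exact (hl' q hq).1.2)
    rw [List.map_append, List.prod_append, List.map_singleton, List.prod_singleton,
      mul_assoc] at h1
    rw [fst_list_prod]
    simp only [List.map_map, Function.comp_def] at h1 h2 ⊢
    rw [h1, h2, add_zero]

end DualWords

/-! ### Functionals on algebras generated by subalgebras -/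

section Span

variable {R : Type*} [Ring R] [Algebra ℂ R] {ι : Type*}

/-- A functional vanishes on the algebra generated by the `B i` if it vanishes on a subspace that
contains `1` and is stable under left multiplication by each `B i`. -/
theorem eq_zero_of_mem_adjoin {θ : R →ₗ[ℂ] ℂ} (B : ι → Subalgebra ℂ R) (S : Submodule ℂ R)
    (h1 : (1 : R) ∈ S) (hmul : ∀ i, ∀ b ∈ B i, ∀ s ∈ S, b * s ∈ S) (hθ : ∀ s ∈ S, θ s = 0)
    {r : R} (hr : r ∈ Algebra.adjoin ℂ (⋃ i, (B i : Set R))) : θ r = 0 := by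
  suffices ∀ s ∈ S, r * s ∈ S from hθ r (by simpa using this 1 h1)
  induction hr using Algebra.adjoin_induction with
  | mem x hx =>
    obtain ⟨i, hi⟩ := Set.mem_iUnion.1 hx
    exact hmul i x hi
  | algebraMap c =>
    intro s hs
    rw [← Algebra.smul_def]
    exact S.smul_mem c hs
  | add x y _ _ hx hy =>
    intro s hs
    rw [add_mul]
    exact S.add_mem (hx s hs) (hy s hs)
  | mul x y _ _ hx hy =>
    intro s hs
    rw [mul_assoc]
    exact hx _ (hy s hs)

/-- The algebra generated by subalgebras `B i` is spanned by the alternating words whose letters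
are centered for a unital functional `σ`. Hence a functional that vanishes on these words, the
empty one included, vanishes on the algebra. -/
theorem eq_zero_of_forall_alternating {σ θ : R →ₗ[ℂ] ℂ} (hσ : σ 1 = 1) (B : ι → Subalgebra ℂ R)
    (hθ : ∀ l : List (ι × R), (l.map Prod.fst).IsChain (· ≠ ·) →
      (∀ p ∈ l, p.2 ∈ B p.1 ∧ σ p.2 = 0) → θ (l.map Prod.snd).prod = 0)
    {r : R} (hr : r ∈ Algebra.adjoin ℂ (⋃ i, (B i : Set R))) : θ r = 0 := by
  set W : Set R := {r | ∃ l : List (ι × R), (l.map Prod.fst).IsChain (· ≠ ·) ∧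
    (∀ p ∈ l, p.2 ∈ B p.1 ∧ σ p.2 = 0) ∧ (l.map Prod.snd).prod = r} with hW
  have hcent : ∀ i, ∀ b ∈ B i, b - algebraMap ℂ R (σ b) ∈ B i ∧
      σ (b - algebraMap ℂ R (σ b)) = 0 := fun i b hb =>
    ⟨sub_mem hb (Subalgebra.algebraMap_mem _ _), by simp [Algebra.algebraMap_eq_smul_one, hσ]⟩
  -- multiplying an alternating word by a letter of a different algebra
  have hne : ∀ (i : ι) (l : List (ι × R)), (i :: l.map Prod.fst).IsChain (· ≠ ·) →
      (∀ p ∈ l, p.2 ∈ B p.1 ∧ σ p.2 = 0) → ∀ b ∈ B i,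
      b * (l.map Prod.snd).prod ∈ Submodule.span ℂ W := by
    intro i l hl hl' b hb
    have e : b * (l.map Prod.snd).prod = (b - algebraMap ℂ R (σ b)) * (l.map Prod.snd).prod +
        σ b • (l.map Prod.snd).prod := by
      rw [sub_mul, Algebra.smul_def, sub_add_cancel]
    rw [e]
    refine add_mem (Submodule.subset_span ⟨(i, b - algebraMap ℂ R (σ b)) :: l, hl, ?_, by simp⟩)
      (Submodule.smul_mem _ _ (Submodule.subset_span ⟨l, hl.tail, hl', rfl⟩))
    intro p hp
    rcases List.mem_cons.1 hp with rfl | hp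
    · exact hcent i b hb
    · exact hl' p hp
  refine eq_zero_of_mem_adjoin B (Submodule.span ℂ W)
    (Submodule.subset_span ⟨[], by simp, by simp, by simp⟩) ?_ ?_ hr
  · intro i b hb s hs
    induction hs using Submodule.span_induction with
    | mem s hs =>
      obtain ⟨l, hl, hl', rfl⟩ := hs
      cases l with
      | nil => exact hne i [] (by simp) (by simp) b hb
      | cons p l =>
        by_cases hp : i = p.1
        · subst hp
          -- letters of the same algebra merge, and their product replaces the first letter
          rw [List.map_cons, List.prod_cons, ← mul_assoc]
          exact hne p.1 l hl (fun q hq => hl' q (List.mem_cons_of_mem _ hq)) _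
            (mul_mem hb (hl' p List.mem_cons_self).1)
        · exact hne i (p :: l) (List.isChain_cons_cons.2 ⟨hp, hl⟩) hl' b hb
    | zero => rw [mul_zero]; exact zero_mem _
    | add s t _ _ hs ht => rw [mul_add]; exact add_mem hs ht
    | smul c s _ hs => rw [mul_smul_comm]; exact Submodule.smul_mem _ _ hs
  · intro s hs
    induction hs using Submodule.span_induction with
    | mem s hs =>
      obtain ⟨l, hl, hl', rfl⟩ := hs
      exact hθ l hl hl'
    | zero => exact map_zero _
    | add s t _ _ hs ht => rw [map_add, hs, ht, add_zero]
    | smul c s _ hs => rw [map_smul, hs, smul_zero]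

theorem eq_zero_of_commute {θ : R →ₗ[ℂ] ℂ} (B₁ B₂ : Subalgebra ℂ R)
    (hcomm : ∀ a ∈ B₁, ∀ b ∈ B₂, Commute a b) (hθ : ∀ a ∈ B₁, ∀ b ∈ B₂, θ (a * b) = 0)
    {r : R} (hr : r ∈ Algebra.adjoin ℂ (⋃ i, (![B₁, B₂] i : Set R))) : θ r = 0 := by
  have h1 := Submodule.mul_mem_mul (B₁.mem_toSubmodule.2 (one_mem B₁))
    (B₂.mem_toSubmodule.2 (one_mem B₂))
  rw [one_mul] at h1
  refine eq_zero_of_mem_adjoin ![B₁, B₂] (B₁.toSubmodule * B₂.toSubmodule) h1 ?_ ?_ hr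
  · intro i b hb s hs
    induction hs using Submodule.mul_induction_on' with
    | mem_mul_mem x hx y hy =>
      match i with
      | 0 =>
        rw [← mul_assoc]
        exact Submodule.mul_mem_mul (mul_mem (S := Subalgebra ℂ R) hb hx) hy
      | 1 =>
        rw [← mul_assoc, ← (hcomm x hx b hb).eq, mul_assoc]
        exact Submodule.mul_mem_mul hx (mul_mem (S := Subalgebra ℂ R) hb hy)
    | add s _ t _ hs ht => rw [mul_add]; exact add_mem hs ht
  · intro s hs
    induction hs using Submodule.mul_induction_on' with
    | mem_mul_mem x hx y hy => exact hθ x hx y hy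
    | add s _ t _ hs ht => rw [map_add, hs, ht, add_zero]

end Span

/-! ### First-order perturbation of a sum -/

section Perturbation

open TrivSqZeroExt

variable {A : Type*} [Ring A] [Algebra ℂ A] {n : ℕ}

/-- The unperturbed tuple generates an algebra without `ε`-parts. -/
theorem mem_adjoin_range_inl {Y : Fin n → A} {x : DualNumber A}
    (hx : x ∈ Algebra.adjoin ℂ (Set.range fun j => (inl (Y j) : DualNumber A))) :
    x.fst ∈ Algebra.adjoin ℂ (Set.range Y) ∧ x.snd = 0 := by
  induction hx using Algebra.adjoin_induction with
  | mem x hx =>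
    obtain ⟨j, rfl⟩ := hx
    exact ⟨Algebra.subset_adjoin ⟨j, rfl⟩, rfl⟩
  | algebraMap c => exact ⟨Subalgebra.algebraMap_mem _ c, rfl⟩
  | add x y _ _ hx hy => exact ⟨add_mem hx.1 hy.1, by rw [snd_add, hx.2, hy.2, add_zero]⟩
  | mul x y _ _ hx hy =>
    exact ⟨mul_mem hx.1 hy.1, by rw [snd_mul_eq, hx.2, hy.2, mul_zero, zero_mul, add_zero]⟩

theorem mem_adjoin_range_perturb {Z ξ : Fin n → A} {W : Subalgebra ℂ A} (hZ : ∀ j, Z j ∈ W)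
    (hξ : ∀ j, ξ j ∈ W) {x : DualNumber A}
    (hx : x ∈ Algebra.adjoin ℂ (Set.range (perturb Z ξ))) :
    x.fst ∈ Algebra.adjoin ℂ (Set.range Z) ∧ x.snd ∈ W := by
  have hle : Algebra.adjoin ℂ (Set.range Z) ≤ W :=
    Algebra.adjoin_le (Set.range_subset_iff.2 hZ)
  induction hx using Algebra.adjoin_induction with
  | mem x hx =>
    obtain ⟨j, rfl⟩ := hx
    rw [fst_perturb, snd_perturb]
    exact ⟨Algebra.subset_adjoin ⟨j, rfl⟩, hξ j⟩
  | algebraMap c => exact ⟨Subalgebra.algebraMap_mem _ c, zero_mem W⟩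
  | add x y _ _ hx hy => exact ⟨add_mem hx.1 hy.1, add_mem hx.2 hy.2⟩
  | mul x y _ _ hx hy =>
    refine ⟨mul_mem hx.1 hy.1, ?_⟩
    rw [snd_mul_eq]
    exact add_mem (mul_mem (hle hx.1) hy.2) (mul_mem hx.2 (hle hy.1))

/-- If the perturbation `Z + ε ξ` does not change the moments of `Z` to first order, then
`Y + Z + ε ξ` does not change those of `Y + Z`, as long as `Y` and `Z` are independent or free.
The entries of `ξ` may lie in an algebra `W` in the closure of `ℂ⟨Z⟩`. -/
theorem epsilonPart_lift_perturb_add {τ : A →ₗ[ℂ] ℂ} (hτ1 : τ 1 = 1)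
    (hτ : ∀ x y, τ (x * y) = τ (y * x)) {Y Z ξ : Fin n → A}
    (hYZ : Independent τ (Algebra.adjoin ℂ (Set.range Y)) (Algebra.adjoin ℂ (Set.range Z)) ∨
      FreelyIndependent τ ![Algebra.adjoin ℂ (Set.range Y), Algebra.adjoin ℂ (Set.range Z)])
    {W : Subalgebra ℂ A} (hZW : ∀ j, Z j ∈ W) (hξW : ∀ j, ξ j ∈ W)
    (hW : ∀ x ∈ W, x ∈ traceClosure τ (Algebra.adjoin ℂ (Set.range Z)))
    (hcomm : ∀ x ∈ W, ∀ a, (∀ j, Commute (Z j) a) → Commute x a)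
    (hξ : ∀ P, epsilonPart τ (FreeAlgebra.lift ℂ (perturb Z ξ) P) = 0)
    (P : FreeAlgebra ℂ (Fin n)) :
    epsilonPart τ (FreeAlgebra.lift ℂ (perturb (Y + Z) ξ) P) = 0 := by
  set B₁ := Algebra.adjoin ℂ (Set.range fun j => (inl (Y j) : DualNumber A)) with hB₁
  set B₂ := Algebra.adjoin ℂ (Set.range (perturb Z ξ)) with hB₂
  have hB₂0 : ∀ x ∈ B₂, τ x.snd = 0 := by
    intro x hx
    rw [hB₂, Algebra.adjoin_range_eq_range_freeAlgebra_lift] at hx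
    obtain ⟨Q, rfl⟩ := hx
    exact hξ Q
  have hmem : FreeAlgebra.lift ℂ (perturb (Y + Z) ξ) P ∈
      Algebra.adjoin ℂ (⋃ i, (![B₁, B₂] i : Set (DualNumber A))) := by
    have h : FreeAlgebra.lift ℂ (perturb (Y + Z) ξ) P ∈
        Algebra.adjoin ℂ (Set.range (perturb (Y + Z) ξ)) := by
      rw [Algebra.adjoin_range_eq_range_freeAlgebra_lift]
      exact ⟨P, rfl⟩
    refine Algebra.adjoin_le (Set.range_subset_iff.2 fun j => ?_) h
    have e : perturb (Y + Z) ξ j = inl (Y j) + perturb Z ξ j := by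
      ext <;> simp
    rw [e]
    exact add_mem
      (Algebra.subset_adjoin (Set.mem_iUnion.2 ⟨0, Algebra.subset_adjoin ⟨j, rfl⟩⟩))
      (Algebra.subset_adjoin (Set.mem_iUnion.2 ⟨1, Algebra.subset_adjoin ⟨j, rfl⟩⟩))
  rcases hYZ with hind | hfree
  · refine eq_zero_of_commute B₁ B₂ (fun a ha b hb => ?_) (fun a ha b hb => ?_) hmem
    · obtain ⟨ha1, ha2⟩ := mem_adjoin_range_inl ha
      obtain ⟨hb1, hb2⟩ := mem_adjoin_range_perturb hZW hξW hb
      refine TrivSqZeroExt.ext (hind _ ha1 _ hb1).1 ?_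
      have hc : Commute b.snd a.fst := hcomm _ hb2 _ fun j =>
        (hind _ ha1 _ (Algebra.subset_adjoin ⟨j, rfl⟩)).1.symm
      rw [snd_mul_eq, snd_mul_eq, ha2, zero_mul, mul_zero, add_zero, zero_add, hc.eq]
    · obtain ⟨ha1, ha2⟩ := mem_adjoin_range_inl ha
      obtain ⟨-, hb2⟩ := mem_adjoin_range_perturb hZW hξW hb
      have key := mem_traceClosure.1 (hW _ hb2) (a.fst - algebraMap ℂ A (τ a.fst))
        fun b' hb' => by
          rw [mul_sub, map_sub, hτ, (hind _ ha1 _ hb').2, Algebra.algebraMap_eq_smul_one,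
            mul_smul_comm, mul_one, map_smul, smul_eq_mul, sub_self]
      rw [mul_sub, map_sub, Algebra.algebraMap_eq_smul_one, mul_smul_comm, mul_one, map_smul,
        hB₂0 b hb, smul_zero, sub_zero] at key
      rw [epsilonPart_apply, snd_mul_eq, ha2, zero_mul, add_zero, hτ, key]
  · refine eq_zero_of_forall_alternating (σ := τ ∘ₗ (fstHom ℂ A A).toLinearMap) hτ1 ![B₁, B₂]
      (fun l hl hl' => ?_) hmem
    have := hfree.apply_mul_snd_list_prod hτ1 hτ l [] (by simpa using hl) (by simp) ?_
    · simpa [epsilonPart_apply] using this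
    · rintro ⟨i, x⟩ hp
      obtain ⟨hx, hx0⟩ := hl' _ hp
      match i with
      | 0 =>
        obtain ⟨h1, h2⟩ := mem_adjoin_range_inl hx
        refine ⟨⟨h1, hx0⟩, ?_, ?_⟩
        · dsimp only
          rw [h2]
          exact zero_mem _
        · dsimp only
          rw [h2, map_zero]
      | 1 =>
        obtain ⟨h1, h2⟩ := mem_adjoin_range_perturb hZW hξW hx
        exact ⟨⟨h1, hx0⟩, hW _ h2, hB₂0 _ hx⟩

end Perturbation

/-! ### Traces and conditional expectations -/

section ConditionalExpectation

variable {H : Type*} [NormedAddCommGroup H] [InnerProductSpace ℂ H] [CompleteSpace H]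
  {M N : VonNeumannAlgebra H} {τ : M.toStarSubalgebra →ₗ[ℂ] ℂ}

theorem IsTraceState.map_star (hτ : IsTraceState M τ) (x : M.toStarSubalgebra) :
    τ (star x) = starRingEnd ℂ (τ x) := by
  have h1 := hτ.im_of_selfAdjoint (a := x + star x) (by simp [add_comm])
  have h2 := hτ.im_of_selfAdjoint (a := Complex.I • (x - star x))
    (by simp [smul_sub, neg_add_eq_sub])
  simp only [map_add, map_sub, map_smul, smul_eq_mul, Complex.add_im, Complex.sub_re,
    Complex.I_mul_im] at h1 h2
  refine Complex.ext ?_ ?_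
  · rw [Complex.conj_re]
    linarith
  · rw [Complex.conj_im]
    linarith

theorem IsCondExp.isSelfAdjoint {E : M.toStarSubalgebra →ₗ[ℂ] M.toStarSubalgebra}
    (hE : IsCondExp M τ N E) {x : M.toStarSubalgebra} (hx : IsSelfAdjoint x) :
    IsSelfAdjoint (E x) := by
  obtain ⟨p, q, hp, hq, rfl⟩ := IsTraceState.exists_posPart x hx
  rw [map_sub]
  exact IsSelfAdjoint.sub
    (Subtype.ext (IsSelfAdjoint.of_nonneg (hE.nonneg p hp)))
    (Subtype.ext (IsSelfAdjoint.of_nonneg (hE.nonneg q hq)))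

theorem IsCondExp.apply_mul {E : M.toStarSubalgebra →ₗ[ℂ] M.toStarSubalgebra}
    (hE : IsCondExp M τ N E) (x : M.toStarSubalgebra) {b : M.toStarSubalgebra}
    (hb : (b : H →L[ℂ] H) ∈ N) : τ (E x * b) = τ (x * b) := by
  have h := hE.bimodule 1 x b (one_mem N) hb
  rw [one_mul, one_mul] at h
  rw [← h, hE.trace_apply]

theorem mem_generatedBy {n : ℕ} (T : Fin n → M.toStarSubalgebra) (j : Fin n) :
    (T j : H →L[ℂ] H) ∈ generatedBy T :=
  subset_vonNeumannGenerated _ (Set.mem_insert_of_mem _ ⟨j, rfl⟩)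

theorem lift_mem_generatedBy {n : ℕ} (T : Fin n → M.toStarSubalgebra)
    (P : FreeAlgebra ℂ (Fin n)) :
    ((FreeAlgebra.lift ℂ T P : M.toStarSubalgebra) : H →L[ℂ] H) ∈ generatedBy T := by
  have h : FreeAlgebra.lift ℂ T P ∈ Algebra.adjoin ℂ (Set.range T) := by
    rw [Algebra.adjoin_range_eq_range_freeAlgebra_lift]
    exact ⟨P, rfl⟩
  exact Algebra.adjoin_le
    (S := (generatedBy T).toStarSubalgebra.toSubalgebra.comap M.toStarSubalgebra.subtype.toAlgHom)
    (Set.range_subset_iff.2 (mem_generatedBy T)) h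

end ConditionalExpectation

end CyclicGrad

theorem proposition5p14 {H : Type*} [NormedAddCommGroup H] [InnerProductSpace ℂ H]
    [CompleteSpace H] (M : VonNeumannAlgebra H) (τ : M.toStarSubalgebra →ₗ[ℂ] ℂ)
    (hτ : CyclicGrad.IsTraceState M τ) (n : ℕ) (Y Z : Fin n → M.toStarSubalgebra)
    (hY : ∀ j, IsSelfAdjoint (Y j)) (hZ : ∀ j, IsSelfAdjoint (Z j))
    (hYZ : CyclicGrad.Independent τ (Algebra.adjoin ℂ (Set.range Y))
        (Algebra.adjoin ℂ (Set.range Z)) ∨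
      CyclicGrad.FreelyIndependent τ
        ![Algebra.adjoin ℂ (Set.range Y), Algebra.adjoin ℂ (Set.range Z)])
    (ξ : Fin n → M.toStarSubalgebra)
    (hξ_mem : ∀ j, (ξ j : H →L[ℂ] H) ∈ CyclicGrad.generatedBy Z)
    (hξ_sa : ∀ j, IsSelfAdjoint (ξ j))
    (hξ : ∀ P : FreeAlgebra ℂ (Fin n),
      τ (∑ j, ξ j * FreeAlgebra.lift ℂ Z (CyclicGrad.cyclicDeriv j P)) = 0) :
    (∀ P : FreeAlgebra ℂ (Fin n),
      τ (∑ j, ξ j * FreeAlgebra.lift ℂ (Y + Z) (CyclicGrad.cyclicDeriv j P)) = 0) ∧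
    (fun j => CyclicGrad.condExp hτ (CyclicGrad.generatedBy_le (Y + Z)) (ξ j)) ∈
      CyclicGrad.cyclicGradientOrthogonal τ (CyclicGrad.generatedBy (Y + Z)) (Y + Z) := by
  have hsum : ∀ P : FreeAlgebra ℂ (Fin n),
      τ (∑ j, ξ j * FreeAlgebra.lift ℂ (Y + Z) (CyclicGrad.cyclicDeriv j P)) = 0 := by
    intro P
    rw [← CyclicGrad.epsilonPart_lift_perturb hτ.map_mul_comm]
    refine CyclicGrad.epsilonPart_lift_perturb_add hτ.map_one hτ.map_mul_comm hYZ
      (W := (CyclicGrad.generatedBy Z).toStarSubalgebra.toSubalgebra.comap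
        M.toStarSubalgebra.subtype.toAlgHom)
      (CyclicGrad.mem_generatedBy Z) hξ_mem (fun x hx => ?_) (fun x hx a ha => ?_)
      (fun Q => (CyclicGrad.epsilonPart_lift_perturb hτ.map_mul_comm Z ξ Q).trans (hξ Q)) P
    · exact fun c hc => CyclicGrad.eq_zero_of_mem_generatedBy (hτ.continuous_apply_mul c) hZ hc hx
    · exact Subtype.ext (CyclicGrad.commute_of_mem_generatedBy hZ hx fun j =>
        congrArg Subtype.val (ha j).eq).eq
  have hE := CyclicGrad.isCondExp_condExp hτ (CyclicGrad.generatedBy_le (Y + Z))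
  have hEsa := fun j => hE.isSelfAdjoint (hξ_sa j)
  -- both `E (ξ j)` and the trace are compatible with `star`, so the sum is a complex conjugate
  refine ⟨hsum, fun j => ⟨hE.mem _, hEsa j⟩, fun P => ?_⟩
  rw [← map_zero (starRingEnd ℂ), ← hsum P, map_sum, map_sum]
  refine Finset.sum_congr rfl fun j _ => ?_
  rw [← hE.apply_mul _ (CyclicGrad.lift_mem_generatedBy _ _), ← hτ.map_star, star_mul,
    (hEsa j).star_eq, hτ.map_mul_comm]
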